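/- Let $\mathbb D$ be the open unit disc, $G=\mathrm{SU}(1,1)$ acting on $\mathbb D$ by $g\cdot z=(az+b)/(\bar bz+\bar a)$, and let $\tilde G$ be the universal covering group of $G$. All bundles are given in a global holomorphic trivialization. A holomorphic Hermitian vector bundle over $\mathbb D$ of rank $n$ is then $\mathbb D\times\mathbb C^n$ with the norms $\|\xi\|_z^2=\langle H(z)\xi,\xi\rangle$, $H$ a smooth function with positive definite values. It is a homogeneous holomorphic Hermitian vector bundle if $\tilde G$ acts on it smoothly by isometric holomorphic bundle automorphisms covering its action on $\mathbb D$; the map from the fibre at $z$ to the fibre at $gz$ is written $J_g(z)^{-1}$, so that $J_{hg}(z)=J_g(z)J_h(gz)$ and $H(gz)=J_g(z)^*H(z)J_g(z)$. Isomorphisms of Hermitian bundles are holomorphic, isometric and cover the identity of $\mathbb D$; isomorphisms of homogeneous bundles also commute with $\tilde G$. Let $\mathfrak{sl}(2,\mathbb C)$ have the elements $h=\frac12\left(\begin{smallmatrix}1&0\\0&-1\end{smallmatrix}\right)$, $y=\left(\begin{smallmatrix}0&0\\1&0\end{smallmatrix}\right)$. The stabilizer of $0$ in $\tilde G$ is the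 one-parameter group $\exp(t\,ih)$, $t\in\mathbb R$; for a homogeneous bundle it acts on the fibre at $0$ by operators $\exp(it\varrho(h))$. The bundle is called elementary if the eigenvalues of $\varrho(h)$ are exactly $-\eta,-(\eta+1),\dots,-(\eta+m)$ for some $\eta\in\mathbb R$ and some integer $m\ge 0$. Let $\eta\in\mathbb R$, let $m\ge0$ and $d_0,\dots,d_m\ge1$ be integers, $d=d_0+\dots+d_m$, and let $Y$ be a complex $d\times d$ matrix whose only nonzero blocks, relative to $\mathbb C^d=\bigoplus_{j=0}^m\mathbb C^{d_j}$, are the subdiagonal ones $Y_j:\mathbb C^{d_{j-1}}\to\mathbb C^{d_j}$, $1\le j\le m$. Let $E^{(\eta,Y)}$ be the bundle holomorphically induced by the representation $\varrho$ with $\varrho(h)=\mathrm{diag}(-\eta I_{d_0},\dots,-(\eta+m)I_{d_m})$ and $\varrho(y)=Y$, with the $\tilde G$-invariant Hermitian structure determined by $H(0)=I$. Explicitly, $J_g(z)$ has the blocks $$J_g(z)_{p,\ell}=\frac{(-c_g)^{p-\ell}}{(p-\ell)!}\,g'(z)^{\eta+\frac{p+\ell}{2}}\,Y_p\cdots Y_{\ell+1}\quad(p\ge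 \ell),\qquad J_g(z)_{p,\ell}=0\quad(p<\ell),$$ where $c_g=\bar b$ is the lower left entry of the matrix of $g$ and the powers of $g'(z)$ are defined by continuation over $\tilde G\times\mathbb D$. Then: (1) Every $E^{(\eta,Y)}$ is an elementary homogeneous holomorphic Hermitian vector bundle, and every elementary homogeneous holomorphic Hermitian vector bundle is isomorphic, as a homogeneous holomorphic Hermitian vector bundle, to some $E^{(\eta,Y)}$. (2) $E^{(\eta,Y)}$ and $E^{(\eta',Y')}$ are isomorphic as homogeneous holomorphic Hermitian vector bundles if and only if $\eta=\eta'$, the blocks of $Y$ and $Y'$ have the same sizes, and $Y'=AYA^{-1}$ for some block diagonal unitary matrix $A$. So the isomorphism classes of elementary homogeneous holomorphic Hermitian vector bundles are parametrized bijectively by the pairs $(\eta,[Y])$, where $[Y]$ is the class of $Y$ under conjugation by block diagonal unitaries. (3) $E^{(\eta,Y)}$ is irreducible, i.e. not isomorphic to an orthogonal direct sum of two bundles of positive rank, if and only if $Y$ does not split as an orthogonal direct sum $Y'\oplus Y''$ of two matrices of positive size and of the same block form, that is, there are no orthogonal decompositions $\mathbb C^{d_j}=V_j'\oplus V_j''$,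 $0\le j\le m$ (single summands may be $0$, but neither all $V_j'$ nor all $V_j''$ are $0$) with $Y_jV'_{j-1}\subseteq V'_j$ and $Y_jV''_{j-1}\subseteq V''_j$ for $1\le j\le m$. This holds both for irreducibility as a homogeneous holomorphic Hermitian vector bundle and for irreducibility as a holomorphic Hermitian vector bundle. -/

import Mathlib

open scoped ContDiff ComplexConjugate ComplexOrder

/-- The open unit disc. -/
abbrev Disc : Set ℂ := Metric.ball (0 : ℂ) 1

/-- The universal covering group of `SU(1,1)` (and of the Möbius group of the disc).
The element `(w, b)` lies over the matrix `(a b; conj b conj a)` with `conj a = exp w`; so `w` is a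
choice of logarithm of the lower right entry. The map `(w, b) ↦ (Im w, b)` identifies this space
with the simply connected space `ℝ × ℂ`, and the fibres of `(w, b) ↦ (exp w, b)` are the orbits of
`w ↦ w + 2πi`. -/
@[ext] structure CoverSU where
  w : ℂ
  b : ℂ
  norm_sq : ‖Complex.exp w‖ ^ 2 - ‖b‖ ^ 2 = 1

namespace CoverSU

/-- The action on the disc, `z ↦ (a z + b) / (conj b z + conj a)`. -/
noncomputable def mob (g : CoverSU) (z : ℂ) : ℂ :=
  (conj (Complex.exp g.w) * z + g.b) / (conj g.b * z + Complex.exp g.w)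

/-- The branch of `log (conj b z + conj a)` on the disc with value `w` at `z = 0`.
As `g'(z) = (conj b z + conj a)⁻²`, the power `g'(z) ^ s` is `exp (-2 s logDenom g z)`. -/
noncomputable def logDenom (g : CoverSU) (z : ℂ) : ℂ :=
  g.w + Complex.log (1 + conj g.b * Complex.exp (-g.w) * z)

lemma det (g : CoverSU) : conj (Complex.exp g.w) * Complex.exp g.w - g.b * conj g.b = 1 := by
  rw [Complex.conj_mul', Complex.mul_conj']
  exact_mod_cast g.norm_sq

lemma norm_lt (g : CoverSU) : ‖conj g.b * Complex.exp (-g.w)‖ < 1 := by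
  have h := g.norm_sq
  have hp : 0 < ‖Complex.exp g.w‖ := norm_pos_iff.2 (Complex.exp_ne_zero _)
  rw [Complex.exp_neg, norm_mul, norm_inv, RCLike.norm_conj, ← div_eq_mul_inv, div_lt_one hp]
  nlinarith [norm_nonneg g.b]

lemma small (g : CoverSU) {z : ℂ} (hz : z ∈ Disc) :
    ‖conj g.b * Complex.exp (-g.w) * z‖ < 1 := by
  rw [norm_mul]
  have h1 := g.norm_lt
  have h2 : ‖z‖ < 1 := by simpa using hz
  nlinarith [norm_nonneg (conj g.b * Complex.exp (-g.w)), norm_nonneg z]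

lemma re_pos {u : ℂ} (hu : ‖u‖ < 1) : 0 < (1 + u).re := by
  have := (abs_le.1 (Complex.abs_re_le_norm u)).1
  simp only [Complex.add_re, Complex.one_re]
  linarith

lemma abs_im_log {u : ℂ} (hu : ‖u‖ < 1) : |(Complex.log (1 + u)).im| < Real.pi / 2 := by
  rw [Complex.log_im]
  exact Complex.abs_arg_lt_pi_div_two_iff.2 (Or.inl (re_pos hu))

lemma exp_log {u : ℂ} (hu : ‖u‖ < 1) : Complex.exp (Complex.log (1 + u)) = 1 + u := by
  apply Complex.exp_log
  intro h
  have := re_pos hu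
  rw [h] at this
  simp at this

lemma exp_logDenom (g : CoverSU) {z : ℂ} (hz : z ∈ Disc) :
    Complex.exp (g.logDenom z) = conj g.b * z + Complex.exp g.w := by
  rw [logDenom, Complex.exp_add, exp_log (g.small hz), Complex.exp_neg]
  field_simp [Complex.exp_ne_zero g.w]
  ring

lemma denom_ne (g : CoverSU) {z : ℂ} (hz : z ∈ Disc) :
    conj g.b * z + Complex.exp g.w ≠ 0 := by
  rw [← g.exp_logDenom hz]; exact Complex.exp_ne_zero _

lemma mob_mem (g : CoverSU) {z : ℂ} (hz : z ∈ Disc) : g.mob z ∈ Disc := by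
  have hne := g.denom_ne hz
  have hz' : ‖z‖ < 1 := by simpa using hz
  have key : ‖conj g.b * z + Complex.exp g.w‖ ^ 2 - ‖conj (Complex.exp g.w) * z + g.b‖ ^ 2
      = 1 - ‖z‖ ^ 2 := by
    have h := g.det
    apply Complex.ofReal_injective
    push_cast
    rw [← Complex.conj_mul', ← Complex.conj_mul', ← Complex.conj_mul']
    simp only [map_add, map_mul, Complex.conj_conj]
    linear_combination (1 - conj z * z) * h
  have hp : 0 < ‖conj g.b * z + Complex.exp g.w‖ := norm_pos_iff.2 hne
  rw [mem_ball_zero_iff, mob, norm_div, div_lt_one hp]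
  nlinarith [norm_nonneg z, norm_nonneg (conj (Complex.exp g.w) * z + g.b)]

lemma zero_mem : (0 : ℂ) ∈ Disc := by simp

lemma exp_mul_w (g h : CoverSU) : Complex.exp (h.w + g.logDenom (h.mob 0))
    = conj g.b * h.b + Complex.exp g.w * Complex.exp h.w := by
  rw [Complex.exp_add, g.exp_logDenom (h.mob_mem zero_mem)]
  simp only [mob, mul_zero, zero_add]
  field_simp [Complex.exp_ne_zero h.w]

/-- Multiplication of matrices, lifted to the covering group. -/
noncomputable instance : Mul CoverSU where
  mul g h :=
    { w := h.w + g.logDenom (h.mob 0)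
      b := conj (Complex.exp g.w) * h.b + g.b * Complex.exp h.w
      norm_sq := by
        rw [exp_mul_w]
        apply Complex.ofReal_injective
        push_cast
        rw [← Complex.conj_mul', ← Complex.conj_mul']
        simp only [map_add, map_mul, Complex.conj_conj]
        linear_combination (conj (Complex.exp h.w) * Complex.exp h.w - h.b * conj h.b) * g.det
          + h.det }

noncomputable instance : One CoverSU := ⟨⟨0, 0, by simp⟩⟩

noncomputable instance : Inv CoverSU where
  inv g := ⟨conj g.w, -g.b, by rw [Complex.exp_conj, RCLike.norm_conj, norm_neg, g.norm_sq]⟩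

lemma mul_w (g h : CoverSU) : (g * h).w = h.w + g.logDenom (h.mob 0) := rfl
lemma mul_b (g h : CoverSU) :
    (g * h).b = conj (Complex.exp g.w) * h.b + g.b * Complex.exp h.w := rfl
lemma exp_w_mul (g h : CoverSU) : Complex.exp (g * h).w
    = conj g.b * h.b + Complex.exp g.w * Complex.exp h.w := exp_mul_w g h
lemma one_w : (1 : CoverSU).w = 0 := rfl
lemma one_b : (1 : CoverSU).b = 0 := rfl
lemma inv_w (g : CoverSU) : (g⁻¹).w = conj g.w := rfl
lemma inv_b (g : CoverSU) : (g⁻¹).b = -g.b := rfl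

lemma mob_mul (g h : CoverSU) {z : ℂ} (hz : z ∈ Disc) : (g * h).mob z = g.mob (h.mob z) := by
  have h1 := (g * h).denom_ne hz
  have h2 := h.denom_ne hz
  have h3 := g.denom_ne (h.mob_mem hz)
  rw [mob, mob, div_eq_div_iff h1 h3]
  rw [exp_w_mul, mul_b] at *
  simp only [mob] at *
  simp only [map_add, map_mul, Complex.conj_conj] at *
  field_simp
  ring

/-- A complex number with trivial exponential and imaginary part below `2π` vanishes. -/
lemma eq_of_exp_eq {x y : ℂ} (h : Complex.exp x = Complex.exp y)
    (him : |x.im - y.im| < 2 * Real.pi) : x = y := by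
  obtain ⟨n, hn⟩ := Complex.exp_eq_exp_iff_exists_int.1 h
  have h1 : x.im - y.im = n * (2 * Real.pi) := by
    rw [hn]; simp
  rw [h1, abs_mul, abs_of_pos (by positivity : (0 : ℝ) < 2 * Real.pi)] at him
  have h2 : |(n : ℝ)| < 1 := by
    by_contra hc
    push Not at hc
    nlinarith [Real.pi_pos]
  have h3 : n = 0 := by
    have : |n| < 1 := by exact_mod_cast h2
    exact Int.abs_lt_one_iff.1 this
  rw [hn, h3]; simp

lemma logDenom_mul (g h : CoverSU) {z : ℂ} (hz : z ∈ Disc) :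
    (g * h).logDenom z = g.logDenom (h.mob z) + h.logDenom z := by
  apply eq_of_exp_eq
  · rw [Complex.exp_add, exp_logDenom _ hz, exp_logDenom _ hz, exp_logDenom _ (h.mob_mem hz),
      exp_w_mul, mul_b, mob]
    have := h.denom_ne hz
    simp only [map_add, map_mul, Complex.conj_conj]
    field_simp
    ring
  · have h1 := abs_lt.1 (abs_im_log ((g * h).small hz))
    have h2 := abs_lt.1 (abs_im_log (g.small (h.mob_mem hz)))
    have h3 := abs_lt.1 (abs_im_log (h.small hz))
    have h4 := abs_lt.1 (abs_im_log (g.small (h.mob_mem zero_mem)))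
    simp only [logDenom, Complex.add_im] at *
    rw [mul_w] at *
    simp only [logDenom, Complex.add_im] at *
    rw [abs_lt]
    constructor <;> linarith [h1.1, h1.2, h2.1, h2.2, h3.1, h3.2, h4.1, h4.2]

lemma logDenom_zero (g : CoverSU) : g.logDenom 0 = g.w := by simp [logDenom]

noncomputable instance : Group CoverSU :=
  Group.ofLeftAxioms
    (fun g h k => by
      ext1
      · rw [mul_w, mul_w, mul_w, logDenom_mul _ _ (k.mob_mem zero_mem), ← mob_mul _ _ zero_mem]
        ring
      · rw [mul_b, mul_b, mul_b, mul_b, exp_w_mul, exp_w_mul]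
        simp only [map_add, map_mul, Complex.conj_conj]
        ring)
    (fun g => by
      ext1
      · rw [mul_w]; simp [logDenom, one_w, one_b]
      · rw [mul_b]; simp [one_w, one_b])
    (fun g => by
      ext1
      · apply eq_of_exp_eq
        · rw [exp_w_mul, inv_w, inv_b, one_w, Complex.exp_conj, map_neg, Complex.exp_zero]
          linear_combination g.det
        · have h4 := abs_lt.1 (abs_im_log ((g⁻¹).small (g.mob_mem zero_mem)))
          rw [mul_w, one_w, logDenom, abs_lt]
          simp only [Complex.add_im, inv_w, Complex.conj_im, Complex.zero_im] at *
          constructor <;> linarith [h4.1, h4.2, Real.pi_pos]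
      · rw [mul_b, inv_w, inv_b, one_b, Complex.exp_conj, Complex.conj_conj]
        ring)

/-- The global real coordinates `(Im w, b) ∈ ℝ × ℂ` of the covering group, as a bijection. They
define its structure of a smooth manifold. -/
noncomputable def coord : ℝ × ℂ ≃ CoverSU where
  toFun p := ⟨((Real.log (1 + ‖p.2‖ ^ 2) / 2 : ℝ) : ℂ) + p.1 * Complex.I, p.2, by
    have h : 0 < 1 + ‖p.2‖ ^ 2 := by positivity
    rw [Complex.norm_exp, ← Real.exp_nat_mul]
    simp only [Complex.add_re, Complex.ofReal_re, Complex.mul_re, Complex.I_re, Complex.I_im,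
      Complex.ofReal_im, mul_zero, mul_one, sub_zero, add_zero]
    rw [show ((2 : ℕ) : ℝ) * (Real.log (1 + ‖p.2‖ ^ 2) / 2) = Real.log (1 + ‖p.2‖ ^ 2) by
      push_cast; ring, Real.exp_log h]
    ring⟩
  invFun g := (g.w.im, g.b)
  left_inv p := by simp
  right_inv g := by
    ext1
    · apply Complex.ext
      · have h := g.norm_sq
        rw [Complex.norm_exp, ← Real.exp_nat_mul] at h
        have h' : 1 + ‖g.b‖ ^ 2 = Real.exp ((2 : ℕ) * g.w.re) := by linarith
        simp [h']
      · simp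
    · rfl

/-- The one-parameter group `exp (t X₀)`, `X₀ = diag (i/2, -i/2)`, that covers the rotations
`z ↦ exp (i t) z`; its image is the stabilizer of `0`. -/
noncomputable def rot (t : ℝ) : CoverSU :=
  ⟨-(Complex.I * t / 2), 0, by
    rw [Complex.norm_exp]; simp⟩

end CoverSU

/- Holomorphic Hermitian vector bundles over the disc, in a global holomorphic trivialization:
the total space is `Disc × ℂ^ι`. Functions are defined on `ℂ`, only their values on the disc matter. -/

/-- All entries of the matrix function `F` are holomorphic on the disc. -/
def HolomorphicOnDisc {ι κ : Type} (F : ℂ → Matrix ι κ ℂ) : Prop :=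
  ∀ i j, DifferentiableOn ℂ (fun z => F z i j) Disc

/-- A holomorphic Hermitian vector bundle over the disc. The square norm of the vector `ξ` of the
fibre at `z` is `⟨H z ξ, ξ⟩`; the positive definite matrix `H z` depends smoothly on `z`. -/
structure HermBundle where
  ι : Type
  [fintype : Fintype ι]
  [decEq : DecidableEq ι]
  H : ℂ → Matrix ι ι ℂ
  posDef : ∀ z ∈ Disc, (H z).PosDef
  smooth : ∀ i j, ContDiffOn ℝ ∞ (fun z => H z i j) Disc

attribute [instance] HermBundle.fintype HermBundle.decEq

/-- A homogeneous holomorphic Hermitian vector bundle over the disc: the covering group acts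
smoothly on the bundle by holomorphic isometric automorphisms that cover its action on the disc.
The linear map from the fibre at `z` to the fibre at `g z` given by `g` is `(J g z)⁻¹`. -/
structure HomBundle extends HermBundle where
  J : CoverSU → ℂ → Matrix ι ι ℂ
  J_holo : ∀ g, HolomorphicOnDisc (J g)
  J_smooth : ∀ i j, ContDiffOn ℝ ∞ (fun p : (ℝ × ℂ) × ℂ => J (CoverSU.coord p.1) p.2 i j)
    (Set.univ ×ˢ Disc)
  J_one : ∀ z ∈ Disc, J 1 z = 1
  J_mul : ∀ h g, ∀ z ∈ Disc, J (h * g) z = J g z * J h (g.mob z)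
  J_isometry : ∀ g, ∀ z ∈ Disc, H (g.mob z) = (J g z).conjTranspose * H z * J g z

namespace HermBundle

/-- `F` is a holomorphic isometric isomorphism `E → E'` of bundles (over the identity of the
disc): `F z` maps the fibre of `E` at `z` to that of `E'`. -/
def IsIso (E E' : HermBundle) (F : ℂ → Matrix E'.ι E.ι ℂ) : Prop :=
  HolomorphicOnDisc F ∧
  (∀ z ∈ Disc, ∃ G : Matrix E.ι E'.ι ℂ, F z * G = 1 ∧ G * F z = 1) ∧
  ∀ z ∈ Disc, (F z).conjTranspose * E'.H z * F z = E.H z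

/-- Isomorphic as holomorphic Hermitian vector bundles. -/
def Isomorphic (E E' : HermBundle) : Prop := ∃ F, IsIso E E' F

/-- The orthogonal direct sum. -/
def sum (E₁ E₂ : HermBundle) : HermBundle where
  ι := E₁.ι ⊕ E₂.ι
  H z := Matrix.fromBlocks (E₁.H z) 0 0 (E₂.H z)
  posDef z hz := by
    have h1 := E₁.posDef z hz
    have h2 := E₂.posDef z hz
    letI := h1.isUnit.invertible
    have h := (Matrix.PosDef.fromBlocks₁₁ (0 : Matrix E₁.ι E₂.ι ℂ) (E₂.H z) h1).2
      (by simpa using h2.posSemidef)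
    rw [Matrix.conjTranspose_zero] at h
    exact h.posDef_iff_isUnit.2 (Matrix.isUnit_fromBlocks_zero₂₁.2 ⟨h1.isUnit, h2.isUnit⟩)
  smooth := by
    rintro (i | i) (j | j)
    · exact E₁.smooth i j
    · exact contDiffOn_const
    · exact contDiffOn_const
    · exact E₂.smooth i j

/-- Irreducible as a holomorphic Hermitian vector bundle: of positive rank and not isomorphic to
an orthogonal direct sum of two such bundles of positive rank. -/
def IsIrreducible (E : HermBundle) : Prop :=
  Nonempty E.ι ∧
  ¬ ∃ E₁ E₂ : HermBundle, Nonempty E₁.ι ∧ Nonempty E₂.ι ∧ E.Isomorphic (E₁.sum E₂)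

end HermBundle

namespace HomBundle

/-- Isomorphic as homogeneous holomorphic Hermitian vector bundles: the isomorphism commutes with
the action of the covering group. -/
def Isomorphic (E E' : HomBundle) : Prop :=
  ∃ F, HermBundle.IsIso E.toHermBundle E'.toHermBundle F ∧
    ∀ g, ∀ z ∈ Disc, E'.J g z * F (g.mob z) = F z * E.J g z

/-- The orthogonal direct sum. -/
def sum (E₁ E₂ : HomBundle) : HomBundle where
  toHermBundle := E₁.toHermBundle.sum E₂.toHermBundle
  J g z := Matrix.fromBlocks (E₁.J g z) 0 0 (E₂.J g z)
  J_holo g := by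
    rintro (i | i) (j | j)
    · exact E₁.J_holo g i j
    · exact differentiableOn_const _
    · exact differentiableOn_const _
    · exact E₂.J_holo g i j
  J_smooth := by
    rintro (i | i) (j | j)
    · exact E₁.J_smooth i j
    · exact contDiffOn_const
    · exact contDiffOn_const
    · exact E₂.J_smooth i j
  J_one z hz := by
    rw [E₁.J_one z hz, E₂.J_one z hz]; exact Matrix.fromBlocks_one
  J_mul h g z hz := by
    rw [E₁.J_mul h g z hz, E₂.J_mul h g z hz]
    refine Eq.trans ?_ (Matrix.fromBlocks_multiply _ _ _ _ _ _ _ _).symm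
    simp only [Matrix.mul_zero, Matrix.zero_mul, add_zero, zero_add]
    rfl
  J_isometry g z hz := by
    change Matrix.fromBlocks (E₁.H (g.mob z)) 0 0 (E₂.H (g.mob z)) =
      (Matrix.fromBlocks (E₁.J g z) 0 0 (E₂.J g z)).conjTranspose *
      Matrix.fromBlocks (E₁.H z) 0 0 (E₂.H z) * Matrix.fromBlocks (E₁.J g z) 0 0 (E₂.J g z)
    rw [E₁.J_isometry g z hz, E₂.J_isometry g z hz]
    simp [Matrix.fromBlocks_conjTranspose, Matrix.fromBlocks_multiply]

/-- Irreducible as a homogeneous holomorphic Hermitian vector bundle: of positive rank and not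
isomorphic to an orthogonal direct sum of two such bundles of positive rank. -/
def IsIrreducible (E : HomBundle) : Prop :=
  Nonempty E.ι ∧
  ¬ ∃ E₁ E₂ : HomBundle, Nonempty E₁.ι ∧ Nonempty E₂.ι ∧ E.Isomorphic (E₁.sum E₂)

/-- `lam` is an eigenvalue of `ϱ(h)`, where `h = -i X₀` and `ϱ` is the action of the stabilizer
of `0` on the fibre at `0`: some nonzero `v` satisfies `ϱ(exp (t X₀)) v = exp (i t lam) v`. -/
def IsWeight (E : HomBundle) (lam : ℂ) : Prop :=
  ∃ v : E.ι → ℂ, v ≠ 0 ∧ ∀ t : ℝ,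
    Matrix.mulVec (E.J (CoverSU.rot t) 0)⁻¹ v = Complex.exp (Complex.I * t * lam) • v

/-- The eigenvalues of `ϱ(h)` form an uninterrupted string `-η, -(η + 1), …, -(η + m)`. -/
def IsElementary (E : HomBundle) : Prop :=
  ∃ (η : ℝ) (m : ℕ), ∀ lam : ℂ, E.IsWeight lam ↔ ∃ j : ℕ, j ≤ m ∧ lam = -((η : ℂ) + j)

end HomBundle

/-- A block subdiagonal matrix on `⨁_{j ≤ m} ℂ^{d j}`; the only nonzero blocks are
`blk j : ℂ^{d j} → ℂ^{d (j + 1)}`, `j < m`. (Blocks may be empty.) -/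
structure BlockMatrix where
  m : ℕ
  d : ℕ → ℕ
  d_zero : ∀ j, m < j → d j = 0
  blk : ∀ j, Matrix (Fin (d (j + 1))) (Fin (d j)) ℂ

namespace BlockMatrix

/-- All the diagonal blocks `0, …, m` have positive size. -/
def Full (Y : BlockMatrix) : Prop := ∀ j ≤ Y.m, 0 < Y.d j

/-- The basis of `⨁_{j ≤ m} ℂ^{d j}`. -/
abbrev Idx (Y : BlockMatrix) : Type := Σ j : Fin (Y.m + 1), Fin (Y.d j)

/-- The whole matrix. -/
def mat (Y : BlockMatrix) : Matrix Y.Idx Y.Idx ℂ := fun p q =>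
  if h : (p.1 : ℕ) = q.1 + 1 then
    Y.blk q.1 (Fin.cast (congrArg Y.d h) p.2) q.2 else 0

/-- Conjugation by block diagonal unitary matrices. (A rectangular matrix with `Uᴴ U = 1` and
`U Uᴴ = 1` is square, so the blocks of `Y` and `Y'` have the same sizes.) -/
def UnitarilyEquiv (Y Y' : BlockMatrix) : Prop :=
  ∃ U : ∀ j, Matrix (Fin (Y'.d j)) (Fin (Y.d j)) ℂ,
    (∀ j, (U j).conjTranspose * U j = 1 ∧ U j * (U j).conjTranspose = 1) ∧
    ∀ j, Y'.blk j * U j = U (j + 1) * Y.blk j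

/-- `Y` splits into an orthogonal direct sum of two nontrivial matrices of the same block form:
every `ℂ^{d j}` is an orthogonal direct sum of `ℂ^{d' j}` and `ℂ^{d'' j}` (one of them possibly
zero), and `Y` is the direct sum of block matrices `Y'` and `Y''` with these blocks. -/
def Splits (Y : BlockMatrix) : Prop :=
  ∃ Y' Y'' : BlockMatrix, Y'.m = Y.m ∧ Y''.m = Y.m ∧
    (∃ j, 0 < Y'.d j) ∧ (∃ j, 0 < Y''.d j) ∧
    ∃ U : ∀ j, Matrix (Fin (Y'.d j) ⊕ Fin (Y''.d j)) (Fin (Y.d j)) ℂ,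
      (∀ j, (U j).conjTranspose * U j = 1 ∧ U j * (U j).conjTranspose = 1) ∧
      ∀ j, Matrix.fromBlocks (Y'.blk j) 0 0 (Y''.blk j) * U j = U (j + 1) * Y.blk j

/-- `exp (s Y)`; note that `Y ^ (m + 1) = 0`. -/
noncomputable def expY (Y : BlockMatrix) (s : ℂ) : Matrix Y.Idx Y.Idx ℂ :=
  ∑ k ∈ Finset.range (Y.m + 1), (s ^ k / (k.factorial : ℂ)) • Y.mat ^ k

/-- `exp (2 l ϱ(h))` for the diagonal matrix `ϱ(h)` with the entries `-(η + j)`. -/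
noncomputable def expH (Y : BlockMatrix) (η : ℝ) (l : ℂ) : Matrix Y.Idx Y.Idx ℂ :=
  Matrix.diagonal fun p => Complex.exp (-(2 * l * ((η : ℂ) + (p.1 : ℕ))))

/-- The representation `ϱ` with the given `ϱ(h)` and `ϱ(y) = Y`, integrated to the universal cover
of the group of the matrices `(exp l, 0; c, exp (-l)) = exp (2 l h) exp (c exp(l) y)`. -/
noncomputable def rho (Y : BlockMatrix) (η : ℝ) (l c : ℂ) : Matrix Y.Idx Y.Idx ℂ :=
  Y.expH η l * Y.expY (c * Complex.exp l)

lemma mat_pow_apply (Y : BlockMatrix) (k : ℕ) (p q : Y.Idx) (h : (p.1 : ℕ) ≠ q.1 + k) :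
    (Y.mat ^ k) p q = 0 := by
  induction k generalizing p with
  | zero =>
    rw [pow_zero, Matrix.one_apply_ne]
    rintro rfl
    exact h rfl
  | succ k ih =>
    rw [pow_succ', Matrix.mul_apply]
    refine Finset.sum_eq_zero fun r _ => ?_
    by_cases hr : (r.1 : ℕ) = q.1 + k
    · rw [mat, dif_neg (by omega), zero_mul]
    · rw [ih r hr, mul_zero]

lemma mat_pow_eq_zero (Y : BlockMatrix) : Y.mat ^ (Y.m + 1) = 0 := by
  ext p q
  exact Y.mat_pow_apply _ _ _ (by have := p.1.2; omega)

lemma expY_eq (Y : BlockMatrix) (s : ℂ) : Y.expY s = IsNilpotent.exp (s • Y.mat) := by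
  rw [IsNilpotent.exp_eq_sum (k := Y.m + 1) (by rw [smul_pow, mat_pow_eq_zero, smul_zero]), expY]
  refine Finset.sum_congr rfl fun k _ => ?_
  rw [smul_pow, ← smul_assoc]
  congr 1
  rw [div_eq_inv_mul, Algebra.smul_def]
  simp

lemma expY_add (Y : BlockMatrix) (s t : ℂ) : Y.expY (s + t) = Y.expY s * Y.expY t := by
  have hn : ∀ s : ℂ, IsNilpotent (s • Y.mat) := fun s =>
    ⟨Y.m + 1, by rw [smul_pow, mat_pow_eq_zero, smul_zero]⟩
  rw [expY_eq, expY_eq, expY_eq, add_smul]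
  exact IsNilpotent.exp_add_of_commute
    (((Commute.refl Y.mat).smul_left s).smul_right t) (hn s) (hn t)

lemma expY_zero (Y : BlockMatrix) : Y.expY 0 = 1 := by
  rw [expY, Finset.sum_range_succ']
  simp

lemma expH_add (Y : BlockMatrix) (η : ℝ) (l l' : ℂ) :
    Y.expH η (l + l') = Y.expH η l * Y.expH η l' := by
  rw [expH, expH, expH, Matrix.diagonal_mul_diagonal]
  congr 1
  ext p
  rw [← Complex.exp_add]
  congr 1
  ring

lemma expH_zero (Y : BlockMatrix) (η : ℝ) : Y.expH η 0 = 1 := by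
  simp [expH]

lemma expY_apply (Y : BlockMatrix) (s : ℂ) (p q : Y.Idx) : Y.expY s p q =
    ∑ k ∈ Finset.range (Y.m + 1), (s ^ k / (k.factorial : ℂ)) * (Y.mat ^ k) p q := by
  simp [expY, Matrix.sum_apply]

lemma expH_mul_expY (Y : BlockMatrix) (η : ℝ) (l s : ℂ) :
    Y.expY s * Y.expH η l = Y.expH η l * Y.expY (Complex.exp (2 * l) * s) := by
  ext p q
  rw [expH, Matrix.mul_diagonal, Matrix.diagonal_mul, expY_apply, expY_apply, Finset.sum_mul,
    Finset.mul_sum]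
  refine Finset.sum_congr rfl fun k _ => ?_
  by_cases h : (p.1 : ℕ) = q.1 + k
  · rw [mul_pow, ← Complex.exp_nat_mul, h]
    have : Complex.exp (-(2 * l * ((η : ℂ) + (q.1 : ℕ)))) =
        Complex.exp (-(2 * l * ((η : ℂ) + ((q.1 + k : ℕ) : ℂ)))) * Complex.exp (k * (2 * l)) := by
      rw [← Complex.exp_add]
      congr 1
      push_cast
      ring
    rw [this]
    ring
  · rw [Y.mat_pow_apply k p q h]
    simp

lemma rho_mul (Y : BlockMatrix) (η : ℝ) (l c l' c' : ℂ) :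
    Y.rho η l c * Y.rho η l' c' =
      Y.rho η (l + l') (c * Complex.exp l' + Complex.exp (-l) * c') := by
  rw [rho, rho, rho, expH_add, Matrix.mul_assoc, ← Matrix.mul_assoc (Y.expY _) (Y.expH _ _),
    expH_mul_expY, Matrix.mul_assoc, ← expY_add, Matrix.mul_assoc]
  congr 3
  rw [Complex.exp_add, Complex.exp_neg, two_mul, Complex.exp_add]
  field_simp [Complex.exp_ne_zero l]

/-- The multiplier `ϱ(p(z)⁻¹ g⁻¹ p(g z))`, where `p(z) = (1, z; 0, 1)` and hence
`p(z)⁻¹ g⁻¹ p(g z) = (c z + d, 0; -c, (c z + d)⁻¹)` for `g = (a, b; c, d)`. -/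
noncomputable def mult (Y : BlockMatrix) (η : ℝ) (g : CoverSU) (z : ℂ) : Matrix Y.Idx Y.Idx ℂ :=
  Y.rho η (g.logDenom z) (-conj g.b)

lemma mult_mul (Y : BlockMatrix) (η : ℝ) (h g : CoverSU) {z : ℂ} (hz : z ∈ Disc) :
    Y.mult η (h * g) z = Y.mult η g z * Y.mult η h (g.mob z) := by
  rw [mult, mult, mult, rho_mul, CoverSU.logDenom_mul _ _ hz, add_comm (h.logDenom _)]
  congr 1
  rw [Complex.exp_neg, g.exp_logDenom hz, h.exp_logDenom (g.mob_mem hz), CoverSU.mul_b,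
    CoverSU.mob]
  have hne := g.denom_ne hz
  simp only [map_add, map_mul, Complex.conj_conj]
  field_simp
  linear_combination (-conj h.b) * g.det

/-- The real part of the exponent of the element of the covering group that maps `0` to `z`. -/
noncomputable def rad (z : ℂ) : ℝ := -(Real.log (1 - ‖z‖ ^ 2) / 2)

/-- `J_g(0)` for the lift `g` of `(1 - |z|²)^(-1/2) (1, z; conj z, 1)`, which maps `0` to `z`. -/
noncomputable def frame (Y : BlockMatrix) (η : ℝ) (z : ℂ) : Matrix Y.Idx Y.Idx ℂ :=
  Y.rho η (rad z) (-(conj z * Complex.exp (rad z)))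

/-- The invariant Hermitian structure with `H(0) = I`. -/
noncomputable def metric (Y : BlockMatrix) (η : ℝ) (z : ℂ) : Matrix Y.Idx Y.Idx ℂ :=
  (Y.frame η z).conjTranspose * Y.frame η z

lemma expH_conj_mul (Y : BlockMatrix) (η : ℝ) (l : ℂ) :
    (Y.expH η l).conjTranspose * Y.expH η l = (Y.expH η l.re).conjTranspose * Y.expH η l.re := by
  simp only [expH, Matrix.diagonal_conjTranspose, Matrix.diagonal_mul_diagonal]
  congr 1
  ext p
  simp only [Pi.star_apply, RCLike.star_def, ← Complex.exp_conj, ← Complex.exp_add]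
  congr 1
  apply Complex.ext <;> simp [Complex.add_re, Complex.mul_re, Complex.mul_im]

lemma metric_mob_zero (Y : BlockMatrix) (η : ℝ) (u : CoverSU) :
    Y.metric η (u.mob 0) = (Y.mult η u 0).conjTranspose * Y.mult η u 0 := by
  have hn : ‖u.mob 0‖ ^ 2 = 1 - (‖Complex.exp u.w‖ ^ 2)⁻¹ := by
    have hp : 0 < ‖Complex.exp u.w‖ := norm_pos_iff.2 (Complex.exp_ne_zero _)
    have h := u.norm_sq
    simp only [CoverSU.mob, mul_zero, zero_add, norm_div, div_pow]
    field_simp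
    linarith
  have hr : rad (u.mob 0) = u.w.re := by
    rw [rad, hn, Complex.norm_exp, sub_sub_cancel, Real.log_inv, Real.log_pow, Real.log_exp]
    push_cast
    ring
  have hs : -(conj (u.mob 0) * Complex.exp (u.w.re : ℂ)) * Complex.exp (u.w.re : ℂ) =
      -conj u.b * Complex.exp u.w := by
    have h2 : Complex.exp (u.w.re : ℂ) * Complex.exp (u.w.re : ℂ) =
        conj (Complex.exp u.w) * Complex.exp u.w := by
      rw [← Complex.exp_conj, ← Complex.exp_add, ← Complex.exp_add, ← Complex.conj_re u.w]
      congr 1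
      apply Complex.ext <;> simp
    have h3 : conj (Complex.exp u.w) ≠ 0 := by simp
    rw [neg_mul, mul_assoc, h2]
    simp only [CoverSU.mob, mul_zero, zero_add, map_div₀]
    field_simp
  rw [metric, frame, mult, CoverSU.logDenom_zero, rho, rho, hr, hs]
  simp only [Matrix.conjTranspose_mul]
  rw [Matrix.mul_assoc, ← Matrix.mul_assoc (Y.expH η _).conjTranspose, ← expH_conj_mul,
    Matrix.mul_assoc, Matrix.mul_assoc]

lemma exists_mob_zero {z : ℂ} (hz : z ∈ Disc) : ∃ u : CoverSU, u.mob 0 = z := by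
  have hz' : ‖z‖ < 1 := by simpa using hz
  have h1 : 0 < 1 - ‖z‖ ^ 2 := by nlinarith [norm_nonneg z]
  refine ⟨⟨rad z, z * Complex.exp (rad z), ?_⟩, ?_⟩
  · rw [norm_mul, Complex.norm_exp, Complex.ofReal_re, mul_pow, ← Real.exp_nat_mul]
    rw [show ((2 : ℕ) : ℝ) * rad z = -Real.log (1 - ‖z‖ ^ 2) by rw [rad]; push_cast; ring,
      Real.exp_neg, Real.exp_log h1]
    field_simp
  · simp only [CoverSU.mob, mul_zero, zero_add]
    field_simp [Complex.exp_ne_zero (rad z : ℂ)]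

lemma expY_smooth (Y : BlockMatrix) {V : Type*} [NormedAddCommGroup V] [NormedSpace ℝ V]
    {f : V → ℂ} {S : Set V} (hf : ContDiffOn ℝ ∞ f S) (p q : Y.Idx) :
    ContDiffOn ℝ ∞ (fun x => Y.expY (f x) p q) S := by
  simp only [expY_apply]
  refine ContDiffOn.sum fun k _ => ContDiffOn.mul (ContDiffOn.div_const (hf.pow k) _)
    contDiffOn_const

lemma rho_smooth (Y : BlockMatrix) (η : ℝ) {V : Type*} [NormedAddCommGroup V] [NormedSpace ℝ V]
    {f c : V → ℂ} {S : Set V} (hf : ContDiffOn ℝ ∞ f S) (hc : ContDiffOn ℝ ∞ c S) (p q : Y.Idx) :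
    ContDiffOn ℝ ∞ (fun x => Y.rho η (f x) (c x) p q) S := by
  simp only [rho, expH, Matrix.diagonal_mul]
  refine ContDiffOn.mul (ContDiffOn.cexp ?_) (Y.expY_smooth (hc.mul hf.cexp) p q)
  exact ((contDiffOn_const.mul hf).mul contDiffOn_const).neg

lemma rho_holo (Y : BlockMatrix) (η : ℝ) {f : ℂ → ℂ} {S : Set ℂ} (c : ℂ)
    (hf : DifferentiableOn ℂ f S) (p q : Y.Idx) :
    DifferentiableOn ℂ (fun x => Y.rho η (f x) c p q) S := by
  simp only [rho, expH, Matrix.diagonal_mul, expY_apply]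
  refine DifferentiableOn.mul ?_ (DifferentiableOn.fun_sum fun k _ => ?_)
  · exact (((differentiableOn_const _).mul hf).mul (differentiableOn_const _)).neg.cexp
  · exact ((((differentiableOn_const _).mul hf.cexp).pow k).div_const _).mul
      (differentiableOn_const _)

lemma rad_smooth : ContDiffOn ℝ ∞ (fun z => ((rad z : ℝ) : ℂ)) Disc := by
  refine Complex.ofRealCLM.contDiff.comp_contDiffOn (g := fun x : ℝ => (x : ℂ)) ?_
  refine ContDiffOn.neg (ContDiffOn.div_const (ContDiffOn.log ?_ ?_) _)
  · exact contDiffOn_const.sub (contDiff_norm_sq ℝ).contDiffOn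
  · intro z hz
    have hz' : ‖z‖ < 1 := by simpa using hz
    nlinarith [norm_nonneg z]

lemma conj_smooth : ContDiff ℝ ∞ (fun z : ℂ => conj z) := Complex.conjCLE.contDiff

lemma metric_smooth (Y : BlockMatrix) (η : ℝ) (p q : Y.Idx) :
    ContDiffOn ℝ ∞ (fun z => Y.metric η z p q) Disc := by
  have hF : ∀ p q, ContDiffOn ℝ ∞ (fun z => Y.frame η z p q) Disc := fun p q =>
    Y.rho_smooth η rad_smooth (conj_smooth.contDiffOn.mul rad_smooth.cexp).neg p q
  simp only [metric, Matrix.mul_apply, Matrix.conjTranspose_apply]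
  exact ContDiffOn.sum fun r _ => (conj_smooth.comp_contDiffOn (hF r p)).mul (hF r q)

lemma rho_isUnit (Y : BlockMatrix) (η : ℝ) (l c : ℂ) : IsUnit (Y.rho η l c) := by
  refine IsUnit.mul ?_ ?_
  · exact IsUnit.of_mul_eq_one _ (by rw [← expH_add, add_neg_cancel, expH_zero] : _ * Y.expH η (-l) = 1)
  · exact IsUnit.of_mul_eq_one _ (by rw [← expY_add, add_neg_cancel, expY_zero] :
      _ * Y.expY (-(c * Complex.exp l)) = 1)

lemma logDenom_smooth : ContDiffOn ℝ ∞
    (fun p : (ℝ × ℂ) × ℂ => (CoverSU.coord p.1).logDenom p.2) (Set.univ ×ˢ Disc) := by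
  have hw : ContDiff ℝ ∞ (fun p : (ℝ × ℂ) × ℂ => (CoverSU.coord p.1).w) := by
    change ContDiff ℝ ∞ (fun p : (ℝ × ℂ) × ℂ =>
      ((Real.log (1 + ‖p.1.2‖ ^ 2) / 2 : ℝ) : ℂ) + p.1.1 * Complex.I)
    refine ContDiff.add ?_ ?_
    · refine Complex.ofRealCLM.contDiff.comp (g := fun x : ℝ => (x : ℂ)) ?_
      refine ContDiff.div_const (ContDiff.log ?_ fun x => by positivity) _
      exact contDiff_const.add ((contDiff_norm_sq ℝ).comp (contDiff_snd.comp contDiff_fst))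
    · exact (Complex.ofRealCLM.contDiff.comp (contDiff_fst.comp contDiff_fst)).mul contDiff_const
  have hb : ContDiff ℝ ∞ (fun p : (ℝ × ℂ) × ℂ => conj (CoverSU.coord p.1).b) :=
    conj_smooth.comp (contDiff_snd.comp contDiff_fst)
  have hu : ContDiff ℝ ∞ (fun p : (ℝ × ℂ) × ℂ => 1 + conj (CoverSU.coord p.1).b *
      Complex.exp (-(CoverSU.coord p.1).w) * p.2) :=
    contDiff_const.add ((hb.mul hw.neg.cexp).mul contDiff_snd)
  refine hw.contDiffOn.add fun p hp => ?_
  have hl : ContDiffAt ℝ ∞ Complex.log (1 + conj (CoverSU.coord p.1).b *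
      Complex.exp (-(CoverSU.coord p.1).w) * p.2) :=
    (Complex.contDiffAt_log
      (Or.inl (CoverSU.re_pos ((CoverSU.coord p.1).small hp.2)))).restrict_scalars ℝ
  exact (hl.comp p hu.contDiffAt).contDiffWithinAt

/-- The homogeneous holomorphic Hermitian vector bundle `E^{(η, Y)}`, holomorphically induced by
`ϱ` and with the Hermitian structure given by `H(0) = I`, in its canonical trivialization. -/
noncomputable def bundle (Y : BlockMatrix) (η : ℝ) : HomBundle where
  ι := Y.Idx
  H := Y.metric η
  posDef z _ := Matrix.PosDef.conjTranspose_mul_self _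
    (Matrix.mulVec_injective_of_isUnit (Y.rho_isUnit η _ _))
  smooth := Y.metric_smooth η
  J := Y.mult η
  J_holo g := Y.rho_holo η _ (DifferentiableOn.add (differentiableOn_const _)
    (DifferentiableOn.clog ((differentiableOn_const _).add
      ((differentiableOn_const _).mul differentiableOn_id))
      fun _ hz => Or.inl (CoverSU.re_pos (g.small hz))))
  J_smooth := Y.rho_smooth η logDenom_smooth
    (conj_smooth.comp (contDiff_snd.comp contDiff_fst)).neg.contDiffOn
  J_one z hz := by
    simp [mult, CoverSU.logDenom, CoverSU.one_w, CoverSU.one_b, rho, expH_zero, expY_zero]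
  J_mul h g z hz := Y.mult_mul η h g hz
  J_isometry g z hz := by
    obtain ⟨u, rfl⟩ := exists_mob_zero hz
    rw [← CoverSU.mob_mul _ _ CoverSU.zero_mem, metric_mob_zero, metric_mob_zero,
      Y.mult_mul η g u CoverSU.zero_mem]
    simp only [Matrix.conjTranspose_mul, Matrix.mul_assoc]

end BlockMatrix

/-! Write `z̄` for `conj z`. The section `CoverSU.lift` of `g ↦ g 0` turns the multiplier into a
frame `J_{lift z}(0)`, which maps the fibre at `z` isometrically onto the fibre at `0`. For `E^{(η,
Y)}` the frame is `exp(-z̄ Y)` times a diagonal matrix, and `exp(-2 rad z) = 1 - |z|²`. Thus an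
entry one level below the diagonal carries one factor `1 - |z|²` more than a diagonal entry, and
first-order terms in `z̄` can be compared with holomorphic ones.

Invariants. An equivariant isometry `F` is determined by `X = F 0`, which is unitary and commutes
with the rotations; so `X` is block diagonal and `η` agrees. On the first subdiagonal, equivariance
under `lift z` reads `z̄ (Y' X - X Y) = (1 - |z|²) F` entrywise. Since `F` is holomorphic, the
`z̄`-derivative at `0` gives `Y' X = X Y` (`eq_zero_of_conj_mul_eq`). Conversely, a block diagonal
unitary intertwiner of the matrices is a constant isomorphism of the bundles (`rho_mul_eq`).

Irreducibility. An orthogonal decomposition, invariant or not, is a holomorphic field `P` of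
orthogonal projections. In the frame, `P` has bounded entries, so its entries above the diagonal are
`O(1 - |z|²)` and vanish by the maximum principle. In the frame the projection is also Hermitian,
hence block diagonal. The same first-order comparison shows that `P 0` commutes with `Y`
(`preservesLevel_and_commutes_of_projection`), and its range and kernel split `Y`. The action is not
used here, so the two notions of irreducibility agree.

Existence. The stabilizer of `0` acts on the fibre at `0` by isometries and is diagonal in an
orthonormal basis (`exists_diagonalization`). The `z̄`-derivative `S` of the frame at `0` shifts its
weights by one, so `Y = -S` is block subdiagonal for an elementary bundle. The only equivariant
candidate for the isomorphism is the quotient of the two frames. The choice of `Y` makes it complex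
differentiable at `0`, and equivariance carries this to every point (`isomorphic_bundle_of_fibre`).
-/

namespace CoverSU

/-! ### The stabilizer of `0` and a section of the orbit map. -/

lemma rot_w (t : ℝ) : (rot t).w = -(Complex.I * t / 2) := rfl
lemma rot_b (t : ℝ) : (rot t).b = 0 := rfl

lemma rot_mob (t : ℝ) (z : ℂ) : (rot t).mob z = Complex.exp (t * Complex.I) * z := by
  simp only [mob, rot_w, rot_b, map_zero, zero_mul, add_zero, zero_add, ← Complex.exp_conj]
  rw [mul_div_right_comm, ← Complex.exp_sub]
  congr 2
  simp [map_ofNat]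
  ring

lemma rot_mob_zero (t : ℝ) : (rot t).mob 0 = 0 := by rw [rot_mob, mul_zero]

lemma rot_add (s t : ℝ) : rot (s + t) = rot s * rot t := by
  ext1
  · rw [mul_w, rot_mob_zero, logDenom_zero]
    simp only [rot_w]
    push_cast
    ring
  · simp [mul_b, rot_b]

lemma rot_zero : rot 0 = 1 := by
  ext1 <;> simp [rot_w, rot_b, one_w, one_b]

lemma rot_neg (t : ℝ) : rot (-t) = (rot t)⁻¹ :=
  eq_inv_of_mul_eq_one_left (by rw [← rot_add, neg_add_cancel, rot_zero])

lemma exists_eq_rot {g : CoverSU} (hg : g.mob 0 = 0) : ∃ t, g = rot t := by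
  have hb : g.b = 0 := by simpa [mob] using hg
  have hw : g.w.re = 0 := by
    have h := g.norm_sq
    rw [hb, Complex.norm_exp, ← Real.exp_nat_mul] at h
    simpa using h
  -- `rot t` has `w = -i t / 2`, so `t` is read off from the imaginary part of `w`.
  refine ⟨-2 * g.w.im, ?_⟩
  ext1
  · rw [rot_w]
    apply Complex.ext <;> simp [hw]; ring
  · rw [rot_b, hb]

/-- A smooth section of the orbit map `g ↦ g 0`. -/
noncomputable def lift (z : ℂ) : CoverSU :=
  coord (0, z * Complex.exp (BlockMatrix.rad z))

lemma one_sub_pos {z : ℂ} (hz : z ∈ Disc) : 0 < 1 - ‖z‖ ^ 2 := by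
  have hz' : ‖z‖ < 1 := by simpa using hz
  nlinarith [norm_nonneg z]

lemma exp_two_rad {z : ℂ} (hz : z ∈ Disc) :
    Real.exp (2 * BlockMatrix.rad z) = (1 - ‖z‖ ^ 2)⁻¹ := by
  rw [show 2 * BlockMatrix.rad z = -Real.log (1 - ‖z‖ ^ 2) by rw [BlockMatrix.rad]; ring,
    Real.exp_neg, Real.exp_log (one_sub_pos hz)]

lemma exp_neg_two_rad {z : ℂ} (hz : z ∈ Disc) :
    Real.exp (-(2 * BlockMatrix.rad z)) = 1 - ‖z‖ ^ 2 := by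
  rw [Real.exp_neg, exp_two_rad hz, inv_inv]

lemma lift_b (z : ℂ) : (lift z).b = z * Complex.exp (BlockMatrix.rad z) := rfl

lemma lift_w {z : ℂ} (hz : z ∈ Disc) : (lift z).w = BlockMatrix.rad z := by
  have h1 := one_sub_pos hz
  have h2 : 1 + ‖z * Complex.exp (BlockMatrix.rad z)‖ ^ 2
      = Real.exp (2 * BlockMatrix.rad z) := by
    rw [norm_mul, Complex.norm_exp, Complex.ofReal_re, mul_pow, ← Real.exp_nat_mul, Nat.cast_two,
      exp_two_rad hz]
    field_simp
    ring
  change ((Real.log (1 + ‖z * Complex.exp (BlockMatrix.rad z)‖ ^ 2) / 2 : ℝ) : ℂ)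
    + ((0 : ℝ) : ℂ) * Complex.I = _
  rw [h2, Real.log_exp]
  simp

lemma lift_zero : lift 0 = 1 := by
  ext1
  · rw [lift_w zero_mem]; simp [BlockMatrix.rad, one_w]
  · rw [lift_b]; simp [one_b]

lemma lift_mob_zero {z : ℂ} (hz : z ∈ Disc) : (lift z).mob 0 = z := by
  rw [mob, lift_w hz, lift_b]
  field_simp [Complex.exp_ne_zero (BlockMatrix.rad z : ℂ)]
  simp

/-- By this decomposition an equivariance relation at `0` needs checking only on the section and on
the rotations. -/
lemma exists_eq_lift_mul_rot (g : CoverSU) : ∃ t, g = lift (g.mob 0) * rot t := by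
  obtain ⟨t, ht⟩ := exists_eq_rot (g := (lift (g.mob 0))⁻¹ * g) (by
    have h := mob_mul (lift (g.mob 0))⁻¹ (lift (g.mob 0)) zero_mem
    rw [lift_mob_zero (g.mob_mem zero_mem), inv_mul_cancel] at h
    rw [mob_mul _ _ zero_mem, ← h]
    simp [mob, one_w, one_b])
  exact ⟨t, by rw [← ht, mul_inv_cancel_left]⟩

lemma norm_exp_mul_I (t : ℝ) (z : ℂ) : ‖Complex.exp (t * Complex.I) * z‖ = ‖z‖ := by
  rw [norm_mul, Complex.norm_exp_ofReal_mul_I, one_mul]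

/-- The section is compatible with conjugation by rotations because `rad` depends only on `|z|`.
Differentiated in `z̄`, this yields the weight shift of `ϱ(y)`. -/
lemma rot_mul_lift_mul_rot (t : ℝ) {z : ℂ} (hz : z ∈ Disc) :
    rot t * (lift z * rot (-t)) = lift (Complex.exp (t * Complex.I) * z) := by
  have hz' : Complex.exp (t * Complex.I) * z ∈ Disc := by
    rwa [mem_ball_zero_iff, norm_exp_mul_I, ← mem_ball_zero_iff]
  have hr : BlockMatrix.rad (Complex.exp (t * Complex.I) * z) = BlockMatrix.rad z := by
    rw [BlockMatrix.rad, BlockMatrix.rad, norm_exp_mul_I]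
  ext1
  · rw [lift_w hz', hr, mul_w, mul_w, rot_mob_zero, logDenom_zero, lift_w hz]
    simp [logDenom, rot_w, rot_b]
    ring
  · rw [lift_b, hr, mul_b, mul_b, lift_b, rot_b, rot_b, rot_w, rot_w, ← Complex.exp_conj]
    simp only [mul_zero, zero_mul, add_zero, zero_add]
    rw [mul_comm (z * _), ← mul_assoc, ← Complex.exp_add, mul_comm z, ← mul_assoc]
    rw [← Complex.exp_add, mul_comm _ z, mul_assoc, mul_left_comm, ← Complex.exp_add]
    congr 2
    simp [map_ofNat]
    ring

lemma differentiableAt_mob (g : CoverSU) {z : ℂ} (hz : z ∈ Disc) :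
    DifferentiableAt ℂ g.mob z := by
  unfold mob
  exact ((differentiableAt_id.const_mul _).add_const _).div
    ((differentiableAt_id.const_mul _).add_const _) (g.denom_ne hz)

end CoverSU

/-- Exponents of complex exponentials on the real line are unique. -/
lemma eq_of_exp_I_mul_eq {x y : ℂ}
    (h : ∀ t : ℝ, Complex.exp (Complex.I * t * x) = Complex.exp (Complex.I * t * y)) : x = y := by
  have hd : ∀ x : ℂ, HasDerivAt (fun t : ℝ => Complex.exp (Complex.I * t * x))
      (Complex.I * x) 0 := by
    intro x
    have h1 : HasDerivAt (fun t : ℝ => Complex.I * (t : ℂ) * x) (Complex.I * 1 * x) 0 :=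
      ((Complex.ofRealCLM.hasDerivAt (x := (0 : ℝ))).const_mul Complex.I).mul_const x
    simpa using h1.cexp
  have h2 := (hd x).unique (by simpa only [h] using hd y)
  exact mul_left_cancel₀ Complex.I_ne_zero h2

/-! ### The frame of `E^{(η, Y)}` and the entries of `exp(sY)`. -/

namespace BlockMatrix

lemma frame_eq_mult (Y : BlockMatrix) (η : ℝ) {z : ℂ} (hz : z ∈ Disc) :
    Y.frame η z = Y.mult η (CoverSU.lift z) 0 := by
  rw [frame, mult, CoverSU.logDenom_zero, CoverSU.lift_w hz, CoverSU.lift_b, map_mul,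
    ← Complex.exp_conj, Complex.conj_ofReal]

/-- In this order the unipotent factor is a polynomial in `z̄` alone, and everything that depends on
`|z|` is diagonal. -/
lemma frame_eq (Y : BlockMatrix) (η : ℝ) (z : ℂ) :
    Y.frame η z = Y.expY (-conj z) * Y.expH η (rad z) := by
  rw [frame, rho, expH_mul_expY, two_mul, Complex.exp_add]
  congr 2
  ring

lemma mult_rot (Y : BlockMatrix) (η : ℝ) (t : ℝ) : Y.mult η (CoverSU.rot t) 0 =
    Matrix.diagonal fun p => Complex.exp (Complex.I * t * ((η : ℂ) + (p.1 : ℕ))) := by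
  rw [mult, CoverSU.logDenom_zero, rho, CoverSU.rot_b, map_zero, neg_zero, zero_mul, expY_zero,
    mul_one, expH, CoverSU.rot_w]
  congr 1
  ext p
  congr 1
  ring

lemma expY_apply_of_lt (Y : BlockMatrix) (s : ℂ) {p q : Y.Idx} (h : (p.1 : ℕ) < q.1) :
    Y.expY s p q = 0 := by
  rw [expY_apply]
  refine Finset.sum_eq_zero fun k _ => ?_
  rw [Y.mat_pow_apply k p q (by omega), mul_zero]

lemma expY_apply_of_eq_add (Y : BlockMatrix) (s : ℂ) {p q : Y.Idx} {k : ℕ}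
    (h : (p.1 : ℕ) = q.1 + k) :
    Y.expY s p q = s ^ k / (k.factorial : ℂ) * (Y.mat ^ k) p q := by
  rw [expY_apply, Finset.sum_eq_single k]
  · intro l _ hl
    rw [Y.mat_pow_apply l p q (by omega), mul_zero]
  · intro hk
    have := p.1.2
    simp at hk
    omega

lemma expY_apply_of_eq (Y : BlockMatrix) (s : ℂ) {p q : Y.Idx} (h : (p.1 : ℕ) = q.1) :
    Y.expY s p q = (1 : Matrix Y.Idx Y.Idx ℂ) p q := by
  rw [Y.expY_apply_of_eq_add s (k := 0) h]
  simp

lemma expY_apply_of_eq_succ (Y : BlockMatrix) (s : ℂ) {p q : Y.Idx} (h : (p.1 : ℕ) = q.1 + 1) :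
    Y.expY s p q = s * Y.mat p q := by
  rw [Y.expY_apply_of_eq_add s (k := 1) h]
  simp

lemma mat_apply_of_ne (Y : BlockMatrix) {p q : Y.Idx} (h : (p.1 : ℕ) ≠ q.1 + 1) :
    Y.mat p q = 0 := dif_neg h

lemma expH_neg_mul (Y : BlockMatrix) (η : ℝ) (l : ℂ) : Y.expH η (-l) * Y.expH η l = 1 := by
  rw [← expH_add, neg_add_cancel, expH_zero]

lemma expY_neg_mul (Y : BlockMatrix) (s : ℂ) : Y.expY (-s) * Y.expY s = 1 := by
  rw [← expY_add, neg_add_cancel, expY_zero]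

/-- The inverse of the frame. -/
noncomputable def frameInv (Y : BlockMatrix) (η : ℝ) (z : ℂ) : Matrix Y.Idx Y.Idx ℂ :=
  Y.expH η (-rad z) * Y.expY (conj z)

lemma frameInv_mul_frame (Y : BlockMatrix) (η : ℝ) (z : ℂ) : Y.frameInv η z * Y.frame η z = 1 := by
  have h := Y.expY_neg_mul (-conj z)
  rw [neg_neg] at h
  rw [frame_eq, frameInv, Matrix.mul_assoc, ← Matrix.mul_assoc (Y.expY _), h, Matrix.one_mul,
    expH_neg_mul]

lemma frame_mul_frameInv (Y : BlockMatrix) (η : ℝ) (z : ℂ) : Y.frame η z * Y.frameInv η z = 1 :=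
  mul_eq_one_comm.1 (Y.frameInv_mul_frame η z)

lemma frame_zero (Y : BlockMatrix) (η : ℝ) : Y.frame η 0 = 1 := by
  simp [frame_eq, expY_zero, rad, expH_zero]

lemma metric_zero (Y : BlockMatrix) (η : ℝ) : Y.metric η 0 = 1 := by
  simp [metric, frame_zero]

end BlockMatrix

/-! ### Two vanishing criteria for holomorphic functions. -/

/-- If `conj z * h z = (1 - |z|²) * k z` with holomorphic `h` and `k`, then `h 0 = 0`. -/
lemma eq_zero_of_conj_mul_eq {h k : ℂ → ℂ} (hh : DifferentiableAt ℂ h 0)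
    (hk : DifferentiableAt ℂ k 0)
    (H : ∀ z ∈ Disc, conj z * h z = (1 - conj z * z) * k z) : h 0 = 0 := by
  have hk0 : k 0 = 0 := by simpa using (H 0 CoverSU.zero_mem).symm
  have hc : HasFDerivAt (fun z : ℂ => conj z) Complex.conjCLE.toContinuousLinearMap (0 : ℂ) :=
    Complex.conjCLE.hasFDerivAt
  have hi : HasFDerivAt (fun z : ℂ => z) (ContinuousLinearMap.id ℝ ℂ) (0 : ℂ) := hasFDerivAt_id _
  have h1 := hc.mul (hh.hasFDerivAt.restrictScalars ℝ)
  have h2 := ((hc.mul hi).const_sub 1).mul (hk.hasFDerivAt.restrictScalars ℝ)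
  have h3 := h1.unique (h2.congr_of_eventuallyEq
    (Filter.eventuallyEq_of_mem (Metric.ball_mem_nhds 0 one_pos) H))
  have e1 := congrArg (fun L : ℂ →L[ℝ] ℂ => L 1) h3
  have e2 := congrArg (fun L : ℂ →L[ℝ] ℂ => L Complex.I) h3
  simp [hk0] at e1 e2
  -- A real linear map `v ↦ a v + s v̄` satisfies `i L(1) - L(i) = 2 i s`. Here `s` is `h 0` on the
  -- left side and `0` on the right, because `k 0 = 0` and `z̄ z` vanishes to second order.
  have e3 : Complex.I * (2 * h 0) = 0 := by linear_combination Complex.I * e1 - e2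
  simpa using e3

/-- A holomorphic function dominated by `1 - |z|²` on the disc vanishes. -/
lemma eq_zero_of_norm_le {f : ℂ → ℂ} {C : ℝ} (hf : DifferentiableOn ℂ f Disc)
    (h : ∀ z ∈ Disc, ‖f z‖ ≤ C * (1 - ‖z‖ ^ 2)) {z : ℂ} (hz : z ∈ Disc) : f z = 0 := by
  have hz' : ‖z‖ < 1 := by simpa using hz
  -- The maximum principle on the disc of radius `r`; then `r → 1`.
  have key : ∀ r ∈ Set.Ioo ‖z‖ 1, ‖f z‖ ≤ C * (1 - r ^ 2) := by
    intro r hr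
    have hr0 : 0 < r := (norm_nonneg z).trans_lt hr.1
    refine Complex.norm_le_of_forall_mem_frontier_norm_le (U := Metric.ball (0 : ℂ) r)
      Metric.isBounded_ball ?_ ?_ (subset_closure (by simpa using hr.1))
    · refine DifferentiableOn.diffContOnCl ?_
      rw [closure_ball _ hr0.ne']
      exact hf.mono (Metric.closedBall_subset_ball hr.2)
    · intro w hw
      rw [frontier_ball _ hr0.ne', mem_sphere_zero_iff_norm] at hw
      simpa only [hw] using h w (by simpa [hw] using hr.2)
  have ht : Filter.Tendsto (fun r : ℝ => C * (1 - r ^ 2)) (nhdsWithin 1 (Set.Iio 1))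
      (nhds (C * (1 - 1 ^ 2))) :=
    ((by fun_prop : Continuous fun r : ℝ => C * (1 - r ^ 2)).tendsto 1).mono_left
      nhdsWithin_le_nhds
  have := ge_of_tendsto ht (Filter.eventually_of_mem (Ioo_mem_nhdsLT hz') key)
  simpa using this

/-! ### Block diagonal intertwiners and the constant isomorphisms they define. -/

namespace BlockMatrix

variable {Y Y' Y'' : BlockMatrix}

lemma sum_idx {f : Y.Idx → ℂ} {j : ℕ} (hj : j < Y.m + 1)
    (hf : ∀ r : Y.Idx, (r.1 : ℕ) ≠ j → f r = 0) : ∑ r, f r = ∑ a, f ⟨⟨j, hj⟩, a⟩ := by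
  rw [Fintype.sum_sigma, Finset.sum_eq_single ⟨j, hj⟩]
  · intro i _ hi
    exact Finset.sum_eq_zero fun a _ => hf _ fun h => hi (Fin.ext h)
  · simp

/-- `X` maps the `j`-th summand to the `j`-th summand. -/
def PreservesLevel (X : Matrix Y'.Idx Y.Idx ℂ) : Prop :=
  ∀ p q, (p.1 : ℕ) ≠ q.1 → X p q = 0

/-- The block diagonal matrix with the given blocks. -/
def levelMatrix (U : ∀ j, Matrix (Fin (Y'.d j)) (Fin (Y.d j)) ℂ) : Matrix Y'.Idx Y.Idx ℂ :=
  fun p q => if h : (p.1 : ℕ) = q.1 then U q.1 (Fin.cast (congrArg Y'.d h) p.2) q.2 else 0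

lemma levelMatrix_mk (U : ∀ j, Matrix (Fin (Y'.d j)) (Fin (Y.d j)) ℂ) {j : ℕ}
    (h' : j < Y'.m + 1) (h : j < Y.m + 1) (a : Fin (Y'.d j)) (b : Fin (Y.d j)) :
    levelMatrix U ⟨⟨j, h'⟩, a⟩ ⟨⟨j, h⟩, b⟩ = U j a b := by
  simp [levelMatrix]

lemma levelMatrix_preservesLevel (U : ∀ j, Matrix (Fin (Y'.d j)) (Fin (Y.d j)) ℂ) :
    PreservesLevel (levelMatrix U) := fun _ _ h => dif_neg h

lemma mat_mk (Y : BlockMatrix) {j : ℕ} (h' : j + 1 < Y.m + 1) (h : j < Y.m + 1)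
    (a : Fin (Y.d (j + 1))) (b : Fin (Y.d j)) :
    Y.mat ⟨⟨j + 1, h'⟩, a⟩ ⟨⟨j, h⟩, b⟩ = Y.blk j a b := by
  simp [mat]

lemma levelMatrix_mul (hm : Y.m = Y'.m) (U : ∀ j, Matrix (Fin (Y''.d j)) (Fin (Y'.d j)) ℂ)
    (W : ∀ j, Matrix (Fin (Y'.d j)) (Fin (Y.d j)) ℂ) :
    levelMatrix U * levelMatrix W = levelMatrix fun j => U j * W j := by
  ext ⟨⟨i, hi⟩, a⟩ ⟨⟨j, hj⟩, b⟩
  rw [Matrix.mul_apply, sum_idx (j := j) (by omega)]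
  · by_cases h : i = j
    · subst h
      simp only [levelMatrix_mk, Matrix.mul_apply]
    · rw [levelMatrix_preservesLevel _ _ _ (by simpa using h)]
      exact Finset.sum_eq_zero fun c _ => by
        rw [levelMatrix_preservesLevel U _ _ (by simpa using h), zero_mul]
  · intro r hr
    rw [levelMatrix_preservesLevel W _ _ (by simpa using hr), mul_zero]

lemma levelMatrix_conjTranspose (U : ∀ j, Matrix (Fin (Y'.d j)) (Fin (Y.d j)) ℂ) :
    (levelMatrix U).conjTranspose = levelMatrix fun j => (U j).conjTranspose := by
  ext ⟨⟨i, hi⟩, a⟩ ⟨⟨j, hj⟩, b⟩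
  rw [Matrix.conjTranspose_apply]
  by_cases h : i = j
  · subst h
    simp only [levelMatrix_mk, Matrix.conjTranspose_apply]
  · rw [levelMatrix_preservesLevel _ _ _ (by simpa using Ne.symm h),
      levelMatrix_preservesLevel _ _ _ (by simpa using h), star_zero]

lemma levelMatrix_one : levelMatrix (fun j => (1 : Matrix (Fin (Y.d j)) (Fin (Y.d j)) ℂ)) = 1 := by
  ext ⟨⟨i, hi⟩, a⟩ ⟨⟨j, hj⟩, b⟩
  by_cases h : i = j
  · subst h
    simp [levelMatrix_mk, Matrix.one_apply]
  · rw [levelMatrix_preservesLevel _ _ _ (by simpa using h), Matrix.one_apply_ne]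
    simp [h]

lemma levelMatrix_add (U W : ∀ j, Matrix (Fin (Y'.d j)) (Fin (Y.d j)) ℂ) :
    levelMatrix U + levelMatrix W = levelMatrix fun j => U j + W j := by
  ext p q
  simp only [levelMatrix, Matrix.add_apply]
  split_ifs <;> simp

lemma levelMatrix_zero :
    levelMatrix (fun j => (0 : Matrix (Fin (Y'.d j)) (Fin (Y.d j)) ℂ)) = 0 := by
  ext p q
  simp [levelMatrix]

lemma eq_of_levelMatrix_eq (hm : Y'.m = Y.m)
    {U W : ∀ j, Matrix (Fin (Y'.d j)) (Fin (Y.d j)) ℂ}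
    (h : levelMatrix U = levelMatrix W) (j : ℕ) : U j = W j := by
  ext a b
  by_cases hj : j < Y.m + 1
  · rw [← levelMatrix_mk U (by omega) hj, h, levelMatrix_mk]
  · have := Y.d_zero j (by omega)
    have := b.2
    omega

/-- The diagonal blocks of a matrix. -/
def levelBlock (X : Matrix Y'.Idx Y.Idx ℂ) (j : ℕ) : Matrix (Fin (Y'.d j)) (Fin (Y.d j)) ℂ :=
  fun a b => if h : j < Y'.m + 1 ∧ j < Y.m + 1 then X ⟨⟨j, h.1⟩, a⟩ ⟨⟨j, h.2⟩, b⟩ else 0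

lemma levelMatrix_levelBlock {X : Matrix Y'.Idx Y.Idx ℂ} (hX : PreservesLevel X) :
    levelMatrix (levelBlock X) = X := by
  ext ⟨⟨i, hi⟩, a⟩ ⟨⟨j, hj⟩, b⟩
  by_cases h : i = j
  · subst h
    rw [levelMatrix_mk, levelBlock, dif_pos ⟨hi, hj⟩]
  · rw [levelMatrix_preservesLevel _ _ _ (by simpa using h), hX _ _ (by simpa using h)]

lemma mat_mul_levelMatrix_mk (U : ∀ j, Matrix (Fin (Y'.d j)) (Fin (Y.d j)) ℂ) {j : ℕ}
    (h' : j + 1 < Y'.m + 1) (h : j < Y.m + 1) (a : Fin (Y'.d (j + 1))) (b : Fin (Y.d j)) :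
    (Y'.mat * levelMatrix U) ⟨⟨j + 1, h'⟩, a⟩ ⟨⟨j, h⟩, b⟩ = (Y'.blk j * U j) a b := by
  rw [Matrix.mul_apply, sum_idx (j := j) (by omega)]
  · simp only [mat_mk, levelMatrix_mk, Matrix.mul_apply]
  · intro r hr
    rw [levelMatrix_preservesLevel U _ _ (by simpa using hr), mul_zero]

lemma levelMatrix_mul_mat_mk (U : ∀ j, Matrix (Fin (Y'.d j)) (Fin (Y.d j)) ℂ) {j : ℕ}
    (h' : j + 1 < Y'.m + 1) (h : j + 1 < Y.m + 1) (a : Fin (Y'.d (j + 1))) (b : Fin (Y.d j)) :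
    (levelMatrix U * Y.mat) ⟨⟨j + 1, h'⟩, a⟩ ⟨⟨j, by omega⟩, b⟩ = (U (j + 1) * Y.blk j) a b := by
  rw [Matrix.mul_apply, sum_idx (j := j + 1) h]
  · simp only [mat_mk, levelMatrix_mk, Matrix.mul_apply]
  · intro r hr
    rw [mat_apply_of_ne _ (by simpa using hr), mul_zero]

lemma mat_mul_apply_of_ne {X : Matrix Y'.Idx Y.Idx ℂ} (hX : PreservesLevel X) {p : Y'.Idx}
    {q : Y.Idx} (h : (p.1 : ℕ) ≠ q.1 + 1) : (Y'.mat * X) p q = 0 := by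
  rw [Matrix.mul_apply]
  refine Finset.sum_eq_zero fun r _ => ?_
  by_cases hr : (r.1 : ℕ) = q.1
  · rw [mat_apply_of_ne _ (by omega), zero_mul]
  · rw [hX _ _ hr, mul_zero]

lemma mul_mat_apply_of_ne {X : Matrix Y'.Idx Y.Idx ℂ} (hX : PreservesLevel X) {p : Y'.Idx}
    {q : Y.Idx} (h : (p.1 : ℕ) ≠ q.1 + 1) : (X * Y.mat) p q = 0 := by
  rw [Matrix.mul_apply]
  refine Finset.sum_eq_zero fun r _ => ?_
  by_cases hr : (p.1 : ℕ) = r.1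
  · rw [mat_apply_of_ne _ (by omega), mul_zero]
  · rw [hX _ _ hr, zero_mul]

/-- For `j ≥ m` the block equation is vacuous, since `d_zero` leaves it without rows; so `Idx` sees
all of the family. -/
lemma mat_mul_levelMatrix_eq_iff (hm : Y'.m = Y.m)
    (U : ∀ j, Matrix (Fin (Y'.d j)) (Fin (Y.d j)) ℂ) :
    Y'.mat * levelMatrix U = levelMatrix U * Y.mat ↔
      ∀ j, Y'.blk j * U j = U (j + 1) * Y.blk j := by
  constructor
  · intro h j
    ext a b
    by_cases hj : j + 1 < Y.m + 1
    · rw [← mat_mul_levelMatrix_mk U (by omega) (by omega), h,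
        levelMatrix_mul_mat_mk U (by omega) hj]
    · have := Y'.d_zero (j + 1) (by omega)
      have := a.2
      omega
  · intro h
    ext ⟨⟨i, hi⟩, a⟩ ⟨⟨j, hj⟩, b⟩
    by_cases hij : i = j + 1
    · subst hij
      rw [mat_mul_levelMatrix_mk U (by omega) (by omega), h,
        ← levelMatrix_mul_mat_mk U (by omega) (by omega)]
    · rw [mat_mul_apply_of_ne (levelMatrix_preservesLevel U) (by simpa using hij),
        mul_mat_apply_of_ne (levelMatrix_preservesLevel U) (by simpa using hij)]

lemma mat_pow_mul {X : Matrix Y'.Idx Y.Idx ℂ} (h : Y'.mat * X = X * Y.mat) (k : ℕ) :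
    Y'.mat ^ k * X = X * Y.mat ^ k := by
  induction k with
  | zero => simp
  | succ k ih => rw [pow_succ, Matrix.mul_assoc, h, ← Matrix.mul_assoc, ih, Matrix.mul_assoc,
      ← pow_succ]

/-- `expY` is a polynomial in `Y`, and `expH` is scalar on each level with the same scalar on both
sides. The equality of the `m` makes both sums end at the same power. -/
lemma rho_mul_eq (hm : Y'.m = Y.m) {X : Matrix Y'.Idx Y.Idx ℂ} (hX : PreservesLevel X)
    (h : Y'.mat * X = X * Y.mat) (η : ℝ) (l c : ℂ) :
    Y'.rho η l c * X = X * Y.rho η l c := by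
  have h1 : Y'.expY (c * Complex.exp l) * X = X * Y.expY (c * Complex.exp l) := by
    rw [expY, expY, Matrix.sum_mul, Matrix.mul_sum]
    exact Finset.sum_congr (congrArg (fun m => Finset.range (m + 1)) hm) fun k _ => by
      rw [Matrix.smul_mul, Matrix.mul_smul, mat_pow_mul h]
  have h2 : Y'.expH η l * X = X * Y.expH η l := by
    ext p q
    rw [expH, expH, Matrix.diagonal_mul, Matrix.mul_diagonal]
    by_cases hpq : (p.1 : ℕ) = q.1
    · rw [hpq, mul_comm]
    · rw [hX _ _ hpq, mul_zero, zero_mul]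
  rw [rho, rho, Matrix.mul_assoc, h1, ← Matrix.mul_assoc, h2, Matrix.mul_assoc]

/-- Applied to frames `D` and `f`: an isometry that intertwines the frames is isometric for the
metrics they define. -/
lemma conjTranspose_mul_conj_mul_eq {m n : Type} [Fintype m] [Fintype n] [DecidableEq n]
    {V : Matrix m n ℂ} {D : Matrix m m ℂ} {f : Matrix n n ℂ} (hV : V.conjTranspose * V = 1)
    (h : D * V = V * f) :
    V.conjTranspose * (D.conjTranspose * D) * V = f.conjTranspose * f := by
  calc V.conjTranspose * (D.conjTranspose * D) * V
      = (D * V).conjTranspose * (D * V) := by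
        simp only [Matrix.conjTranspose_mul, Matrix.mul_assoc]
    _ = f.conjTranspose * (V.conjTranspose * V) * f := by
        rw [h]; simp only [Matrix.conjTranspose_mul, Matrix.mul_assoc]
    _ = _ := by rw [hV, Matrix.mul_one]

lemma bundle_isomorphic_of_unitarilyEquiv {η : ℝ} {Y₁ Y₂ : BlockMatrix} (h₁ : Y₁.Full)
    (h₂ : Y₂.Full) (h : Y₁.UnitarilyEquiv Y₂) : (Y₁.bundle η).Isomorphic (Y₂.bundle η) := by
  obtain ⟨U, hU, hUY⟩ := h
  have hd : ∀ j, Y₂.d j = Y₁.d j := fun j => by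
    have := Matrix.square_of_invertible (U j) (U j).conjTranspose (hU j).2 (hU j).1
    simpa using this
  -- `UnitarilyEquiv` compares only the block sizes. `Full` and `d_zero` make `m` the last index of
  -- a nonempty block.
  have hm : Y₂.m = Y₁.m := by
    by_contra hne
    rcases lt_or_gt_of_ne hne with hlt | hlt
    · have := h₁ _ le_rfl
      rw [← hd, Y₂.d_zero _ hlt] at this
      omega
    · have := h₂ _ le_rfl
      rw [hd, Y₁.d_zero _ hlt] at this
      omega
  have hX := levelMatrix_preservesLevel U
  have hXY := (mat_mul_levelMatrix_eq_iff hm U).2 hUY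
  have hX1 : (levelMatrix U).conjTranspose * levelMatrix U = 1 := by
    rw [levelMatrix_conjTranspose, levelMatrix_mul hm.symm]
    simp only [(hU _).1, levelMatrix_one]
  have hX2 : levelMatrix U * (levelMatrix U).conjTranspose = 1 := by
    rw [levelMatrix_conjTranspose, levelMatrix_mul hm]
    simp only [(hU _).2, levelMatrix_one]
  refine ⟨fun _ => levelMatrix U, ⟨fun i j => differentiableOn_const _,
    fun z _ => ⟨_, hX2, hX1⟩, fun z _ => ?_⟩, fun g z _ => rho_mul_eq hm hX hXY η _ _⟩
  exact conjTranspose_mul_conj_mul_eq hX1 (rho_mul_eq hm hX hXY η _ _)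

/-- The two row blocks `A`, `B` of the unitary are separate intertwiners to `Y'` and `Y''`; stacked,
they form a constant equivariant isometry. Some blocks of `Y'` and `Y''` may be empty, so `Full` is
not available for them, but positive rank is. -/
lemma bundle_isomorphic_sum_of_splits (η : ℝ) (h : Y.Splits) : ∃ E₁ E₂ : HomBundle,
    Nonempty E₁.ι ∧ Nonempty E₂.ι ∧ (Y.bundle η).Isomorphic (E₁.sum E₂) := by
  obtain ⟨Y', Y'', hm', hm'', ⟨j', hj'⟩, ⟨j'', hj''⟩, U, hU, hUY⟩ := h
  refine ⟨Y'.bundle η, Y''.bundle η, ⟨⟨⟨j', ?_⟩, ⟨0, hj'⟩⟩⟩, ⟨⟨⟨j'', ?_⟩, ⟨0, hj''⟩⟩⟩, ?_⟩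
  · by_contra hc
    rw [Y'.d_zero j' (by omega)] at hj'
    omega
  · by_contra hc
    rw [Y''.d_zero j'' (by omega)] at hj''
    omega
  have hY : ∀ j, Y'.blk j * (U j).toRows₁ = (U (j + 1)).toRows₁ * Y.blk j ∧
      Y''.blk j * (U j).toRows₂ = (U (j + 1)).toRows₂ * Y.blk j := fun j => by
    have h := hUY j
    rw [← Matrix.fromRows_toRows (U j), ← Matrix.fromRows_toRows (U (j + 1)),
      Matrix.fromBlocks_mul_fromRows, Matrix.fromRows_mul, Matrix.fromRows_inj.eq_iff] at h
    simpa using h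
  set A := levelMatrix fun j => (U j).toRows₁
  set B := levelMatrix fun j => (U j).toRows₂
  have hA := levelMatrix_preservesLevel fun j => (U j).toRows₁
  have hB := levelMatrix_preservesLevel fun j => (U j).toRows₂
  have hAY := (mat_mul_levelMatrix_eq_iff hm' _).2 fun j => (hY j).1
  have hBY := (mat_mul_levelMatrix_eq_iff hm'' _).2 fun j => (hY j).2
  have h1 : A.conjTranspose * A + B.conjTranspose * B = 1 := by
    simp only [A, B, levelMatrix_conjTranspose]
    rw [levelMatrix_mul hm'.symm, levelMatrix_mul hm''.symm, levelMatrix_add, ← levelMatrix_one]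
    congr 1
    ext1 j
    have h := (hU j).1
    rwa [← Matrix.fromRows_toRows (U j), Matrix.conjTranspose_fromRows_eq_fromCols_conjTranspose,
      Matrix.fromCols_mul_fromRows] at h
  have h2 : Matrix.fromRows A B * (Matrix.fromRows A B).conjTranspose = 1 := by
    have h3 : ∀ j, (U j).toRows₁ * (U j).toRows₁.conjTranspose = 1 ∧
        (U j).toRows₁ * (U j).toRows₂.conjTranspose = 0 ∧
        (U j).toRows₂ * (U j).toRows₁.conjTranspose = 0 ∧
        (U j).toRows₂ * (U j).toRows₂.conjTranspose = 1 := fun j => by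
      have h := (hU j).2
      rw [← Matrix.fromRows_toRows (U j), Matrix.conjTranspose_fromRows_eq_fromCols_conjTranspose,
        Matrix.fromRows_mul_fromCols, ← Matrix.fromBlocks_one, Matrix.fromBlocks_inj] at h
      simpa using h
    rw [Matrix.conjTranspose_fromRows_eq_fromCols_conjTranspose, Matrix.fromRows_mul_fromCols,
      ← Matrix.fromBlocks_one]
    simp only [A, B, levelMatrix_conjTranspose]
    rw [levelMatrix_mul hm', levelMatrix_mul hm', levelMatrix_mul hm'', levelMatrix_mul hm'']
    simp only [h3, levelMatrix_one, levelMatrix_zero]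
  have h1' : (Matrix.fromRows A B).conjTranspose * Matrix.fromRows A B = 1 := by
    rw [Matrix.conjTranspose_fromRows_eq_fromCols_conjTranspose, Matrix.fromCols_mul_fromRows, h1]
  have hr : ∀ l c, Matrix.fromBlocks (Y'.rho η l c) 0 0 (Y''.rho η l c) * Matrix.fromRows A B =
      Matrix.fromRows A B * Y.rho η l c := fun l c => by
    rw [Matrix.fromBlocks_mul_fromRows, Matrix.fromRows_mul, rho_mul_eq hm' hA hAY,
      rho_mul_eq hm'' hB hBY]
    simp [A, B]
  refine ⟨fun _ => Matrix.fromRows A B, ⟨fun i j => differentiableOn_const _,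
    fun z _ => ⟨_, h2, h1'⟩, fun z _ => ?_⟩, fun g z _ => hr _ _⟩
  refine Eq.trans ?_ (conjTranspose_mul_conj_mul_eq h1' (hr _ _))
  rw [Matrix.fromBlocks_conjTranspose, Matrix.fromBlocks_multiply]
  simp only [Matrix.conjTranspose_zero, Matrix.mul_zero, Matrix.zero_mul, add_zero, zero_add]
  rfl

end BlockMatrix

/-! ### Inverses of the multiplier, and the weights of `E^{(η, Y)}`. -/

namespace HomBundle

lemma J_inv_mul_J (E : HomBundle) (g : CoverSU) {z : ℂ} (hz : z ∈ Disc) :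
    E.J g⁻¹ (g.mob z) * E.J g z = 1 :=
  mul_eq_one_comm.1 (by rw [← E.J_mul _ _ z hz, inv_mul_cancel, E.J_one z hz])

lemma J_mul_J_inv (E : HomBundle) (g : CoverSU) {z : ℂ} (hz : z ∈ Disc) :
    E.J g z * E.J g⁻¹ (g.mob z) = 1 :=
  mul_eq_one_comm.1 (E.J_inv_mul_J g hz)

lemma J_rot_inv (E : HomBundle) (t : ℝ) :
    (E.J (CoverSU.rot t) 0)⁻¹ = E.J (CoverSU.rot (-t)) 0 := by
  apply Matrix.inv_eq_left_inv
  have h := E.J_inv_mul_J (CoverSU.rot t) CoverSU.zero_mem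
  rwa [CoverSU.rot_mob_zero, ← CoverSU.rot_neg] at h

end HomBundle

namespace BlockMatrix

variable {Y : BlockMatrix}

lemma bundle_isElementary (η : ℝ) (hY : Y.Full) : (Y.bundle η).IsElementary := by
  have hJ : ∀ t : ℝ, ((Y.bundle η).J (CoverSU.rot t) 0)⁻¹ = Matrix.diagonal
      fun p : Y.Idx => Complex.exp (Complex.I * t * -((η : ℂ) + (p.1 : ℕ))) := fun t => by
    rw [HomBundle.J_rot_inv]
    refine (Y.mult_rot η (-t)).trans ?_
    congr 1
    ext p
    push_cast
    congr 1
    ring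
  refine ⟨η, Y.m, fun lam => ⟨?_, ?_⟩⟩
  · rintro ⟨v, hv, h⟩
    obtain ⟨p, hp⟩ := Function.ne_iff.1 hv
    refine ⟨p.1, by have := p.1.2; omega, (eq_of_exp_I_mul_eq fun t => ?_)⟩
    have h1 := congrFun (h t) p
    rw [hJ t] at h1
    erw [Matrix.mulVec_diagonal] at h1
    exact (mul_right_cancel₀ hp h1).symm
  · rintro ⟨j, hj, rfl⟩
    let p : Y.Idx := ⟨⟨j, by omega⟩, ⟨0, hY j hj⟩⟩
    have h0 : (Pi.single p 1 : Y.Idx → ℂ) ≠ 0 := by simp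
    have h1 : ∀ f : Y.Idx → ℂ, (Matrix.diagonal f).mulVec (Pi.single p 1) =
        f p • (Pi.single p 1 : Y.Idx → ℂ) := fun f => by
      ext r
      rcases eq_or_ne r p with rfl | hr
      · simp
      · simp [hr]
    refine ⟨(Pi.single p 1 : Y.Idx → ℂ), h0, fun t => ?_⟩
    rw [hJ t]
    exact h1 _

variable {Y' Y'' : BlockMatrix}

/-! ### Triangular matrices and the invariants of an isomorphism. -/

/-- Block lower triangular matrices. -/
def IsLower (A : Matrix Y'.Idx Y.Idx ℂ) : Prop := ∀ p q, (p.1 : ℕ) < q.1 → A p q = 0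

lemma PreservesLevel.isLower {A : Matrix Y'.Idx Y.Idx ℂ} (hA : PreservesLevel A) : IsLower A :=
  fun p q h => hA p q h.ne

lemma isLower_expY (Y : BlockMatrix) (s : ℂ) : IsLower (Y.expY s) :=
  fun _ _ h => Y.expY_apply_of_lt s h

lemma IsLower.mul {A : Matrix Y''.Idx Y'.Idx ℂ} {B : Matrix Y'.Idx Y.Idx ℂ} (hA : IsLower A)
    (hB : IsLower B) : IsLower (A * B) := by
  intro p q h
  rw [Matrix.mul_apply]
  refine Finset.sum_eq_zero fun r _ => ?_
  rcases lt_or_ge (p.1 : ℕ) r.1 with hr | hr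
  · rw [hA _ _ hr, zero_mul]
  · rw [hB _ _ (hr.trans_lt h), mul_zero]

lemma IsLower.expY_mul_apply {A : Matrix Y'.Idx Y.Idx ℂ} (hA : IsLower A) (s : ℂ) {p : Y'.Idx}
    {q : Y.Idx} (h : (p.1 : ℕ) = q.1) : (Y'.expY s * A) p q = A p q := by
  conv_rhs => rw [← Matrix.one_mul A]
  rw [Matrix.mul_apply, Matrix.mul_apply]
  refine Finset.sum_congr rfl fun r _ => ?_
  rcases lt_trichotomy (r.1 : ℕ) q.1 with hr | hr | hr
  · rw [hA _ _ hr, mul_zero, mul_zero]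
  · rw [Y'.expY_apply_of_eq s (by omega)]
  · rw [Y'.expY_apply_of_lt s (by omega), Matrix.one_apply_ne (by rintro rfl; omega)]

/-- `expY s` is the identity on the diagonal blocks and `s Y` just below them. Against a lower
triangular factor, an entry one level below the diagonal meets only these two terms. -/
lemma IsLower.expY_mul_apply_succ {A : Matrix Y'.Idx Y.Idx ℂ} (hA : IsLower A) (s : ℂ)
    {p : Y'.Idx} {q : Y.Idx} (h : (p.1 : ℕ) = q.1 + 1) :
    (Y'.expY s * A) p q = A p q + s * (Y'.mat * A) p q := by
  conv_rhs => enter [1]; rw [← Matrix.one_mul A]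
  rw [Matrix.mul_apply, Matrix.mul_apply, Matrix.mul_apply, Finset.mul_sum,
    ← Finset.sum_add_distrib]
  refine Finset.sum_congr rfl fun r _ => ?_
  rcases lt_trichotomy (r.1 : ℕ) q.1 with hr | hr | hr
  · simp [hA _ _ hr]
  · rw [Y'.expY_apply_of_eq_succ s (by omega), Matrix.one_apply_ne (by rintro rfl; omega)]
    ring
  · rw [Y'.mat_apply_of_ne (by omega)]
    rcases eq_or_ne (p.1 : ℕ) r.1 with hp | hp
    · rw [Y'.expY_apply_of_eq s hp]
      ring
    · rw [Y'.expY_apply_of_lt s (by omega), Matrix.one_apply_ne (by rintro rfl; exact hp rfl)]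
      ring

lemma IsLower.mul_expY_apply_succ {A : Matrix Y'.Idx Y.Idx ℂ} (hA : IsLower A) (s : ℂ)
    {p : Y'.Idx} {q : Y.Idx} (h : (p.1 : ℕ) = q.1 + 1) :
    (A * Y.expY s) p q = A p q + s * (A * Y.mat) p q := by
  conv_rhs => enter [1]; rw [← Matrix.mul_one A]
  rw [Matrix.mul_apply, Matrix.mul_apply, Matrix.mul_apply, Finset.mul_sum,
    ← Finset.sum_add_distrib]
  refine Finset.sum_congr rfl fun r _ => ?_
  rcases lt_trichotomy (p.1 : ℕ) r.1 with hr | hr | hr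
  · simp [hA _ _ hr]
  · rw [Y.expY_apply_of_eq_succ s (by omega), Matrix.one_apply_ne (by rintro rfl; omega)]
    ring
  · rw [Y.mat_apply_of_ne (by omega)]
    rcases eq_or_ne (r.1 : ℕ) q.1 with hp | hp
    · rw [Y.expY_apply_of_eq s hp]
      ring
    · rw [Y.expY_apply_of_lt s (by omega), Matrix.one_apply_ne (by rintro rfl; exact hp rfl)]
      ring

/-- `Y` uses up the whole level difference, so the other factor enters only through its diagonal
blocks. -/
lemma mul_mat_congr {A B : Matrix Y'.Idx Y.Idx ℂ}
    (hAB : ∀ p q, (p.1 : ℕ) = q.1 → A p q = B p q) {p : Y'.Idx} {q : Y.Idx}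
    (h : (p.1 : ℕ) = q.1 + 1) : (A * Y.mat) p q = (B * Y.mat) p q := by
  rw [Matrix.mul_apply, Matrix.mul_apply]
  refine Finset.sum_congr rfl fun r _ => ?_
  rcases eq_or_ne (p.1 : ℕ) r.1 with hr | hr
  · rw [hAB _ _ hr]
  · rw [Y.mat_apply_of_ne (by omega), mul_zero, mul_zero]

lemma exp_neg_two_rad {z : ℂ} (hz : z ∈ Disc) :
    Complex.exp (-(2 * (rad z : ℂ))) = 1 - conj z * z := by
  rw [Complex.conj_mul']
  exact_mod_cast congrArg Complex.ofReal (CoverSU.exp_neg_two_rad hz)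

lemma expH_exponent (η l : ℂ) (j : ℕ) : Complex.exp (-(2 * l * (η + ((j + 1 : ℕ) : ℂ)))) =
    Complex.exp (-(2 * l)) * Complex.exp (-(2 * l * (η + (j : ℂ)))) := by
  rw [← Complex.exp_add]
  congr 1
  push_cast
  ring

/-- Isomorphic bundles `E^{(η, Y)}` have unitarily equivalent parameters. -/
lemma eq_and_unitarilyEquiv_of_isomorphic {η₁ η₂ : ℝ} {Y₁ Y₂ : BlockMatrix} (h₁ : Y₁.Full)
    (h₂ : Y₂.Full) (h : (Y₁.bundle η₁).Isomorphic (Y₂.bundle η₂)) :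
    η₁ = η₂ ∧ Y₁.UnitarilyEquiv Y₂ := by
  obtain ⟨F, ⟨hF, hinv, hiso⟩, hJ⟩ := h
  change ℂ → Matrix Y₂.Idx Y₁.Idx ℂ at F
  replace hJ : ∀ g, ∀ z ∈ Disc, Y₂.mult η₂ g z * F (g.mob z) = F z * Y₁.mult η₁ g z := hJ
  replace hinv : ∀ z ∈ Disc, ∃ G : Matrix Y₁.Idx Y₂.Idx ℂ, F z * G = 1 ∧ G * F z = 1 := hinv
  have hX1 : (F 0).conjTranspose * F 0 = 1 := by
    have h := hiso 0 CoverSU.zero_mem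
    change (F 0).conjTranspose * Y₂.metric η₂ 0 * F 0 = Y₁.metric η₁ 0 at h
    rwa [metric_zero, metric_zero, Matrix.mul_one] at h
  have hX2 : F 0 * (F 0).conjTranspose = 1 := by
    obtain ⟨G, hG1, hG2⟩ := hinv 0 CoverSU.zero_mem
    have : (F 0).conjTranspose = G := by
      rw [← Matrix.mul_one (F 0).conjTranspose, ← hG1, ← Matrix.mul_assoc, hX1, Matrix.one_mul]
    rw [this, hG1]
  -- Commuting with the rotations allows nonzero entries only between equal weights.
  have hlev : ∀ p q, F 0 p q ≠ 0 → η₁ + (q.1 : ℕ) = η₂ + (p.1 : ℕ) := by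
    intro p q hpq
    have h : Complex.ofReal (η₁ + (q.1 : ℕ)) = Complex.ofReal (η₂ + (p.1 : ℕ)) := by
      apply eq_of_exp_I_mul_eq
      intro t
      have h := congrFun (congrFun (hJ (CoverSU.rot t) 0 CoverSU.zero_mem) p) q
      rw [CoverSU.rot_mob_zero, mult_rot, mult_rot, Matrix.diagonal_mul, Matrix.mul_diagonal,
        mul_comm (F 0 p q)] at h
      push_cast
      exact (mul_right_cancel₀ hpq h).symm
    exact_mod_cast h
  have hcol : ∀ q, ∃ p, F 0 p q ≠ 0 := by
    intro q
    by_contra! hc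
    have h := congrFun (congrFun hX1 q) q
    simp [Matrix.mul_apply, hc] at h
  have hrow : ∀ p, ∃ q, F 0 p q ≠ 0 := by
    intro p
    by_contra! hc
    have h := congrFun (congrFun hX2 p) p
    simp [Matrix.mul_apply, hc] at h
  -- The lowest weight of each side must occur on the other side, which gives both inequalities. The
  -- highest level gives `m` in the same way below.
  have hη : η₁ = η₂ := by
    obtain ⟨p, hp⟩ := hcol ⟨⟨0, by omega⟩, ⟨0, h₁ 0 (Nat.zero_le _)⟩⟩
    obtain ⟨q, hq⟩ := hrow ⟨⟨0, by omega⟩, ⟨0, h₂ 0 (Nat.zero_le _)⟩⟩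
    have e1 := hlev _ _ hp
    have e2 := hlev _ _ hq
    have : (0 : ℝ) ≤ ((p.1 : ℕ) : ℝ) := Nat.cast_nonneg _
    have : (0 : ℝ) ≤ ((q.1 : ℕ) : ℝ) := Nat.cast_nonneg _
    simp only [Nat.cast_zero] at e1 e2
    linarith
  subst hη
  have hX : PreservesLevel (F 0) := by
    intro p q hpq
    by_contra hc
    have := hlev p q hc
    have h : ((q.1 : ℕ) : ℝ) = ((p.1 : ℕ) : ℝ) := by linarith
    exact hpq (by exact_mod_cast h.symm)
  have hm : Y₂.m = Y₁.m := by
    obtain ⟨p, hp⟩ := hcol ⟨⟨Y₁.m, by omega⟩, ⟨0, h₁ _ le_rfl⟩⟩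
    obtain ⟨q, hq⟩ := hrow ⟨⟨Y₂.m, by omega⟩, ⟨0, h₂ _ le_rfl⟩⟩
    have e1 := mt (hX _ _) hp
    have e2 := mt (hX _ _) hq
    have := p.1.2
    have := q.1.2
    simp only [not_not] at e1 e2
    omega
  have hXY : Y₂.mat * F 0 = F 0 * Y₁.mat := by
    -- Equivariance under `lift z`, with the unipotent factor of the left frame moved to the right.
    have key : ∀ z ∈ Disc, Y₂.expH η₁ (rad z) * F z =
        Y₂.expY (conj z) * F 0 * Y₁.expY (-conj z) * Y₁.expH η₁ (rad z) := by
      intro z hz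
      have h := hJ (CoverSU.lift z) 0 CoverSU.zero_mem
      rw [CoverSU.lift_mob_zero hz, ← frame_eq_mult _ _ hz, ← frame_eq_mult _ _ hz, frame_eq,
        frame_eq] at h
      have h' := congrArg (Y₂.expY (conj z) * ·) h
      have h1 := Y₂.expY_neg_mul (-conj z)
      rw [neg_neg] at h1
      simp only [← Matrix.mul_assoc] at h' ⊢
      rwa [h1, Matrix.one_mul] at h'
    ext p q
    by_cases hpq : (p.1 : ℕ) = q.1 + 1
    -- On the first subdiagonal, after cancelling `exp(-2 rad z (η + q))`, `key` says that `z̄`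
    -- times the constant `Y₂ X - X Y₁` equals `(1 - |z|²) F z`, where `X = F 0`.
    · have := eq_zero_of_conj_mul_eq (h := fun _ => (Y₂.mat * F 0 - F 0 * Y₁.mat) p q)
        (k := fun z => F z p q) (differentiableAt_const _)
        ((hF p q).differentiableAt (Metric.ball_mem_nhds 0 one_pos)) ?_
      · simpa [sub_eq_zero] using this
      intro z hz
      have hk := congrFun (congrFun (key z hz) p) q
      rw [expH, expH, Matrix.diagonal_mul, Matrix.mul_diagonal] at hk
      rw [((isLower_expY _ _).mul hX.isLower).mul_expY_apply_succ _ hpq,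
        hX.isLower.expY_mul_apply_succ _ hpq, hX p q (by omega),
        mul_mat_congr (fun p q h => hX.isLower.expY_mul_apply _ h) hpq, hpq, expH_exponent,
        exp_neg_two_rad hz] at hk
      have hne := Complex.exp_ne_zero (-(2 * (rad z : ℂ) * ((η₁ : ℂ) + ((q.1 : ℕ) : ℂ))))
      apply mul_right_cancel₀ hne
      rw [Matrix.sub_apply]
      linear_combination -hk
    · rw [mat_mul_apply_of_ne hX hpq, mul_mat_apply_of_ne hX hpq]
  refine ⟨rfl, levelBlock (F 0), fun j => ⟨?_, ?_⟩, (mat_mul_levelMatrix_eq_iff hm _).1 ?_⟩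
  · refine eq_of_levelMatrix_eq
      (U := fun j => (levelBlock (F 0) j).conjTranspose * levelBlock (F 0) j)
      (W := fun j => 1) rfl ?_ j
    rw [← levelMatrix_mul hm.symm fun j => (levelBlock (F 0) j).conjTranspose,
      ← levelMatrix_conjTranspose, levelMatrix_levelBlock hX, hX1, levelMatrix_one]
  · refine eq_of_levelMatrix_eq
      (U := fun j => levelBlock (F 0) j * (levelBlock (F 0) j).conjTranspose)
      (W := fun j => 1) rfl ?_ j
    rw [← levelMatrix_mul hm _ fun j => (levelBlock (F 0) j).conjTranspose,
      ← levelMatrix_conjTranspose, levelMatrix_levelBlock hX, hX2, levelMatrix_one]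
  · rw [levelMatrix_levelBlock hX, hXY]

end BlockMatrix

/-! ### Holomorphic fields of projections and irreducibility. -/

/-- The inverse of an invertible holomorphic matrix function is holomorphic. -/
lemma HolomorphicOnDisc.inv {n : Type} [Fintype n] [DecidableEq n] {M : ℂ → Matrix n n ℂ}
    (hM : HolomorphicOnDisc M) (hu : ∀ z ∈ Disc, IsUnit (M z)) :
    HolomorphicOnDisc fun z => (M z)⁻¹ := by
  have hdet : ∀ N : ℂ → Matrix n n ℂ, HolomorphicOnDisc N →
      DifferentiableOn ℂ (fun z => (N z).det) Disc := fun N hN => by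
    simp only [Matrix.det_apply]
    exact DifferentiableOn.fun_sum fun σ _ =>
      (DifferentiableOn.fun_finsetProd fun i _ => hN _ _).const_smul _
  intro i j
  -- Cramer's rule: the entries of the inverse are quotients of determinants of holomorphic
  -- matrices.
  simp only [Matrix.inv_def, Matrix.smul_apply, Ring.inverse_eq_inv', Matrix.adjugate_apply]
  refine ((hdet M hM).inv fun z hz => ?_).smul (hdet _ fun k l => ?_)
  · exact ((Matrix.isUnit_iff_isUnit_det _).1 (hu z hz)).ne_zero
  · simp only [Matrix.updateRow_apply]
    split_ifs
    · exact differentiableOn_const _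
    · exact hM k l

lemma HolomorphicOnDisc.mul {l m n : Type} [Fintype m] {M : ℂ → Matrix l m ℂ}
    {N : ℂ → Matrix m n ℂ} (hM : HolomorphicOnDisc M) (hN : HolomorphicOnDisc N) :
    HolomorphicOnDisc fun z => M z * N z := by
  intro i j
  simp only [Matrix.mul_apply]
  exact DifferentiableOn.fun_sum fun k _ => (hM i k).mul (hN k j)

/-- The entries of an orthogonal projection have absolute value at most `1`. -/
lemma norm_apply_le_one_of_isHermitian {n : Type} [Fintype n] {A : Matrix n n ℂ}
    (hA : A.IsHermitian) (h : A * A = A) (p q : n) : ‖A p q‖ ≤ 1 := by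
  -- `A = A A*` makes a diagonal entry the square norm of its row. Hence `‖A p p‖² ≤ ‖A p p‖`, and
  -- every entry of the row is bounded by `1`.
  have h1 : A p p = ((∑ r, ‖A p r‖ ^ 2 : ℝ) : ℂ) := by
    conv_lhs => rw [← h, Matrix.mul_apply]
    push_cast
    exact Finset.sum_congr rfl fun r _ => by
      rw [← Complex.mul_conj', ← hA.apply r p, RCLike.star_def]
  have h2 : ‖A p p‖ = ∑ r, ‖A p r‖ ^ 2 := by
    conv_lhs => rw [h1]
    rw [Complex.norm_real, Real.norm_of_nonneg (Finset.sum_nonneg fun _ _ => by positivity)]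
  have h3 : ∀ r, ‖A p r‖ ^ 2 ≤ ‖A p p‖ := fun r => by
    rw [h2]
    exact Finset.single_le_sum (f := fun r => ‖A p r‖ ^ 2) (fun _ _ => by positivity)
      (Finset.mem_univ r)
  have h4 := h3 p
  have h5 := h3 q
  have h6 : ‖A p p‖ ≤ 1 := by
    by_contra! hc
    nlinarith
  exact (sq_le_one_iff₀ (norm_nonneg _)).1 (h5.trans h6)

/-- The projection onto the first summand. -/
abbrev fstProj (m n : Type) [DecidableEq m] : Matrix (m ⊕ n) (m ⊕ n) ℂ :=
  Matrix.fromBlocks 1 0 0 0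

/-- An orthogonal projection is diagonal in a suitable orthonormal basis. -/
lemma exists_unitary_mul_eq_fromBlocks {n : Type} [Fintype n] [DecidableEq n] {A : Matrix n n ℂ}
    (hA : A.IsHermitian) (h : A * A = A) :
    ∃ (a b : ℕ) (U : Matrix (Fin a ⊕ Fin b) n ℂ),
      (U.conjTranspose * U = 1 ∧ U * U.conjTranspose = 1) ∧
      U * A = fstProj (Fin a) (Fin b) * U := by
  set V : Matrix n n ℂ := (hA.eigenvectorUnitary : Matrix n n ℂ)
  have hV1 : V.conjTranspose * V = 1 := Unitary.coe_star_mul_self _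
  have hV2 : V * V.conjTranspose = 1 := Unitary.coe_mul_star_self _
  have hd : V.conjTranspose * A =
      Matrix.diagonal (fun i => (hA.eigenvalues i : ℂ)) * V.conjTranspose := by
    have h1 := hA.spectral_theorem
    rw [Unitary.conjStarAlgAut_apply] at h1
    conv_lhs => rw [h1]
    change V.conjTranspose * (V * _ * V.conjTranspose) = _
    rw [Matrix.mul_assoc, ← Matrix.mul_assoc, hV1, Matrix.one_mul]
    rfl
  have hl : ∀ i, (hA.eigenvalues i : ℂ) = if hA.eigenvalues i = 1 then 1 else 0 := by
    intro i
    have h1 : Matrix.diagonal (fun i => (hA.eigenvalues i : ℂ)) *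
        Matrix.diagonal (fun i => (hA.eigenvalues i : ℂ)) =
        Matrix.diagonal (fun i => (hA.eigenvalues i : ℂ)) := by
      have e : Matrix.diagonal (fun i => (hA.eigenvalues i : ℂ)) = V.conjTranspose * A * V := by
        rw [hd, Matrix.mul_assoc, hV1, Matrix.mul_one]
      rw [e]
      calc V.conjTranspose * A * V * (V.conjTranspose * A * V)
          = V.conjTranspose * A * (V * V.conjTranspose) * A * V := by
            simp only [Matrix.mul_assoc]
        _ = V.conjTranspose * (A * A) * V := by
            rw [hV2, Matrix.mul_one]; simp only [Matrix.mul_assoc]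
        _ = _ := by rw [h]
    have h2 := congrFun (congrFun h1 i) i
    rw [Matrix.diagonal_mul_diagonal, Matrix.diagonal_apply_eq, Matrix.diagonal_apply_eq] at h2
    split_ifs with h3
    · rw [h3, Complex.ofReal_one]
    · have h4 : hA.eigenvalues i * hA.eigenvalues i = hA.eigenvalues i := by exact_mod_cast h2
      have h5 : hA.eigenvalues i * (hA.eigenvalues i - 1) = 0 := by linarith
      rcases mul_eq_zero.1 h5 with h6 | h6
      · rw [h6, Complex.ofReal_zero]
      · exact absurd (by linarith) h3
  -- Sorts the eigenbasis, the eigenvalue `1` first; by `hl` the other eigenvalues are `0`.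
  let e : Fin (Fintype.card {i // hA.eigenvalues i = 1}) ⊕
      Fin (Fintype.card {i // ¬ hA.eigenvalues i = 1}) ≃ n :=
    ((Fintype.equivFin _).symm.sumCongr (Fintype.equivFin _).symm).trans
      (Equiv.sumCompl fun i => hA.eigenvalues i = 1)
  refine ⟨_, _, V.conjTranspose.submatrix e id, ⟨?_, ?_⟩, ?_⟩
  · rw [Matrix.conjTranspose_submatrix, Matrix.conjTranspose_conjTranspose,
      Matrix.submatrix_mul_equiv, hV2, Matrix.submatrix_id_id]
  · rw [Matrix.conjTranspose_submatrix, Matrix.conjTranspose_conjTranspose,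
      ← Matrix.submatrix_mul _ _ e id e Function.bijective_id, hV1,
      Matrix.submatrix_one_equiv]
  · have hb : fstProj (Fin _) (Fin _) =
        (Matrix.diagonal (fun i => (hA.eigenvalues i : ℂ))).submatrix e e := by
      rw [Matrix.submatrix_diagonal_equiv, fstProj, ← Matrix.diagonal_one, ← Matrix.diagonal_zero,
        Matrix.fromBlocks_diagonal]
      congr 1
      ext (i | i)
      · simp [hl, e]
        exact ((Fintype.equivFin _).symm i).2
      · simp [hl, e]
        exact ((Fintype.equivFin _).symm i).2
    rw [hb, Matrix.submatrix_mul_equiv, ← hd]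
    rfl

namespace BlockMatrix

variable {Y : BlockMatrix}

/-- Each diagonal block of `A` is an orthogonal projection, and its range and kernel are the two
summands of that level. Commuting with `A` is what makes `Y` respect them. -/
lemma splits_of_projection {A : Matrix Y.Idx Y.Idx ℂ} (hA : A.IsHermitian) (hAA : A * A = A)
    (hlev : PreservesLevel A) (hYA : Y.mat * A = A * Y.mat) (h0 : A ≠ 0) (h1 : A ≠ 1) :
    Y.Splits := by
  have hAl := levelMatrix_levelBlock hlev
  set π := levelBlock A
  rw [← hAl, mat_mul_levelMatrix_eq_iff rfl] at hYA
  have hπ1 : ∀ j, (π j).IsHermitian := fun j =>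
    eq_of_levelMatrix_eq (U := fun j => (π j).conjTranspose) rfl
      (by rw [← levelMatrix_conjTranspose, hAl]; exact hA) j
  have hπ2 : ∀ j, π j * π j = π j := fun j =>
    eq_of_levelMatrix_eq (U := fun j => π j * π j) rfl
      (by rw [← levelMatrix_mul rfl π π, hAl, hAA]) j
  choose a b U hU hUπ using fun j => exists_unitary_mul_eq_fromBlocks (hπ1 j) (hπ2 j)
  have hd : ∀ j, a j + b j = Y.d j := fun j => by
    have := Matrix.square_of_invertible (U j) (U j).conjTranspose (hU j).2 (hU j).1
    simpa using this
  have hZ : ∀ j, ∃ (Z₁ : Matrix (Fin (a (j + 1))) (Fin (a j)) ℂ)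
      (Z₂ : Matrix (Fin (b (j + 1))) (Fin (b j)) ℂ),
      Matrix.fromBlocks Z₁ 0 0 Z₂ * U j = U (j + 1) * Y.blk j := by
    intro j
    set Z := U (j + 1) * Y.blk j * (U j).conjTranspose
    have hQ : ∀ j, fstProj (Fin (a j)) (Fin (b j)) = U j * π j * (U j).conjTranspose := fun j => by
      rw [hUπ, Matrix.mul_assoc, (hU j).2, Matrix.mul_one]
    -- In the adapted bases the block of `Y` commutes with the standard projections, so its
    -- off-diagonal corners vanish.
    have hc : Z * fstProj (Fin (a j)) (Fin (b j)) =
        fstProj (Fin (a (j + 1))) (Fin (b (j + 1))) * Z := by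
      rw [hQ j]
      calc Z * (U j * π j * (U j).conjTranspose)
          = U (j + 1) * Y.blk j * ((U j).conjTranspose * U j) * π j * (U j).conjTranspose := by
            simp only [Z, Matrix.mul_assoc]
        _ = U (j + 1) * (Y.blk j * π j) * (U j).conjTranspose := by
            rw [(hU j).1, Matrix.mul_one]; simp only [Matrix.mul_assoc]
        _ = fstProj (Fin (a (j + 1))) (Fin (b (j + 1))) * Z := by
            rw [hYA, ← Matrix.mul_assoc, hUπ]; simp only [Z, Matrix.mul_assoc]
    rw [← Matrix.fromBlocks_toBlocks Z, fstProj, fstProj, Matrix.fromBlocks_multiply,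
      Matrix.fromBlocks_multiply,
      Matrix.fromBlocks_inj] at hc
    simp only [Matrix.mul_one, Matrix.mul_zero, add_zero, Matrix.zero_mul, Matrix.one_mul,
      true_and, and_true] at hc
    refine ⟨Z.toBlocks₁₁, Z.toBlocks₂₂, ?_⟩
    have hZ' : Matrix.fromBlocks Z.toBlocks₁₁ 0 0 Z.toBlocks₂₂ = Z := by
      conv_rhs => rw [← Matrix.fromBlocks_toBlocks Z, ← hc.1, hc.2]
    rw [hZ']
    simp only [Z, Matrix.mul_assoc, (hU j).1, Matrix.mul_one]
  choose Z₁ Z₂ hZ using hZ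
  refine ⟨⟨Y.m, a, fun j hj => ?_, Z₁⟩, ⟨Y.m, b, fun j hj => ?_, Z₂⟩, rfl, rfl, ?_, ?_, U, hU, hZ⟩
  · have := Y.d_zero j hj
    have := hd j
    omega
  · have := Y.d_zero j hj
    have := hd j
    omega
  · by_contra! hc
    apply h0
    rw [← hAl, ← levelMatrix_zero]
    congr 1
    ext1 j
    have hj : a j = 0 := Nat.le_zero.1 (hc j)
    have : IsEmpty (Fin (a j)) := by rw [hj]; infer_instance
    have hQ : fstProj (Fin (a j)) (Fin (b j)) = 0 := by
      ext (i | i) (k | k)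
      · exact isEmptyElim i
      all_goals rfl
    rw [← Matrix.one_mul (π j), ← (hU j).1, Matrix.mul_assoc, hUπ, hQ, Matrix.zero_mul,
      Matrix.mul_zero]
  · by_contra! hc
    apply h1
    rw [← hAl, ← levelMatrix_one]
    congr 1
    ext1 j
    have hj : b j = 0 := Nat.le_zero.1 (hc j)
    have : IsEmpty (Fin (b j)) := by rw [hj]; infer_instance
    have hQ : fstProj (Fin (a j)) (Fin (b j)) = 1 := by
      rw [fstProj, ← Matrix.fromBlocks_one, Matrix.fromBlocks_inj]
      exact ⟨rfl, rfl, rfl, Subsingleton.elim _ _⟩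
    rw [← Matrix.one_mul (π j), ← (hU j).1, Matrix.mul_assoc, hUπ, hQ, Matrix.one_mul]

end BlockMatrix

namespace BlockMatrix

variable {Y Y' : BlockMatrix}

lemma IsLower.mul_expY_apply {A : Matrix Y'.Idx Y.Idx ℂ} (hA : IsLower A) (s : ℂ) {p : Y'.Idx}
    {q : Y.Idx} (h : (p.1 : ℕ) = q.1) : (A * Y.expY s) p q = A p q := by
  conv_rhs => rw [← Matrix.mul_one A]
  rw [Matrix.mul_apply, Matrix.mul_apply]
  refine Finset.sum_congr rfl fun r _ => ?_
  rcases lt_trichotomy (p.1 : ℕ) r.1 with hr | hr | hr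
  · rw [hA _ _ hr, zero_mul, zero_mul]
  · rw [Y.expY_apply_of_eq s (by omega)]
  · rw [Y.expY_apply_of_lt s (by omega), Matrix.one_apply_ne (by rintro rfl; omega)]

lemma mat_mul_congr {A B : Matrix Y'.Idx Y.Idx ℂ}
    (hAB : ∀ p q, (p.1 : ℕ) = q.1 → A p q = B p q) {p : Y'.Idx} {q : Y.Idx}
    (h : (p.1 : ℕ) = q.1 + 1) : (Y'.mat * A) p q = (Y'.mat * B) p q := by
  rw [Matrix.mul_apply, Matrix.mul_apply]
  refine Finset.sum_congr rfl fun r _ => ?_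
  rcases eq_or_ne (r.1 : ℕ) q.1 with hr | hr
  · rw [hAB _ _ hr]
  · rw [Y'.mat_apply_of_ne (by omega), zero_mul, zero_mul]

/-- Only uniformity over `‖s‖ ≤ 1` matters: the coefficients `s ^ k / k!` are at most `1`, and the
sum over all entries of all powers is a crude bound. -/
lemma exists_norm_expY_le (Y : BlockMatrix) :
    ∃ K : ℝ, 0 ≤ K ∧ ∀ s : ℂ, ‖s‖ ≤ 1 → ∀ p q, ‖Y.expY s p q‖ ≤ K := by
  refine ⟨∑ p, ∑ q, ∑ k ∈ Finset.range (Y.m + 1), ‖(Y.mat ^ k) p q‖, by positivity,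
    fun s hs p q => ?_⟩
  have h1 : ‖Y.expY s p q‖ ≤ ∑ k ∈ Finset.range (Y.m + 1), ‖(Y.mat ^ k) p q‖ := by
    rw [expY_apply]
    refine (norm_sum_le _ _).trans (Finset.sum_le_sum fun k _ => ?_)
    rw [norm_mul, norm_div, norm_pow, Complex.norm_natCast]
    refine mul_le_of_le_one_left (norm_nonneg _) (div_le_one_of_le₀ ?_ (by positivity))
    exact (pow_le_one₀ (norm_nonneg _) hs).trans (by exact_mod_cast k.factorial_pos)
  refine h1.trans ((Finset.single_le_sum (f := fun q =>
    ∑ k ∈ Finset.range (Y.m + 1), ‖(Y.mat ^ k) p q‖) (fun _ _ => by positivity)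
    (Finset.mem_univ q)).trans ?_)
  exact Finset.single_le_sum (f := fun p => ∑ q,
    ∑ k ∈ Finset.range (Y.m + 1), ‖(Y.mat ^ k) p q‖) (fun _ _ => by positivity)
    (Finset.mem_univ p)

lemma norm_mul_mul_apply_le {n : Type} [Fintype n] {A B C : Matrix n n ℂ} {K : ℝ} (hK : 0 ≤ K)
    (hA : ∀ p q, ‖A p q‖ ≤ K) (hB : ∀ p q, ‖B p q‖ ≤ 1) (hC : ∀ p q, ‖C p q‖ ≤ K) (p q : n) :
    ‖(A * B * C) p q‖ ≤ Fintype.card n * (Fintype.card n * K * K) := by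
  have h1 : ∀ p q, ‖(A * B) p q‖ ≤ Fintype.card n * K := fun p q => by
    rw [Matrix.mul_apply]
    refine (norm_sum_le _ _).trans ((Finset.sum_le_card_nsmul _ _ K fun r _ => ?_).trans_eq ?_)
    · rw [norm_mul, ← mul_one K]
      exact mul_le_mul (hA p r) (hB r q) (norm_nonneg _) hK
    · rw [nsmul_eq_mul, Finset.card_univ]
  rw [Matrix.mul_apply]
  refine (norm_sum_le _ _).trans
    ((Finset.sum_le_card_nsmul _ _ (Fintype.card n * K * K) fun r _ => ?_).trans_eq ?_)
  · rw [norm_mul]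
    exact mul_le_mul (h1 p r) (hC r q) (norm_nonneg _) (by positivity)
  · rw [nsmul_eq_mul, Finset.card_univ]

/-- A holomorphic field of orthogonal projections of the bundle `E^{(η, Y)}` commutes at `0` with
`ϱ(h)` and `ϱ(y)`. -/
lemma preservesLevel_and_commutes_of_projection {η : ℝ} {P : ℂ → Matrix Y.Idx Y.Idx ℂ}
    (hP : HolomorphicOnDisc P) (hPP : ∀ z ∈ Disc, P z * P z = P z)
    (hHP : ∀ z ∈ Disc, (Y.metric η z * P z).IsHermitian) :
    PreservesLevel (P 0) ∧ Y.mat * P 0 = P 0 * Y.mat := by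
  -- `φ` is `P` carried to the fibre at `0`, an orthogonal projection for the standard metric. `ψ`
  -- differs from `φ` by the unipotent factor and from `P` by diagonal factors only.
  set φ : ℂ → Matrix Y.Idx Y.Idx ℂ := fun z => Y.frame η z * P z * Y.frameInv η z
  set ψ : ℂ → Matrix Y.Idx Y.Idx ℂ := fun z => Y.expH η (rad z) * P z * Y.expH η (-rad z)
  have hφH : ∀ z ∈ Disc, (φ z).IsHermitian := by
    intro z hz
    have h1 : (Y.frameInv η z).conjTranspose * (Y.frame η z).conjTranspose = 1 := by
      rw [← Matrix.conjTranspose_mul, frame_mul_frameInv, Matrix.conjTranspose_one]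
    have h2 : φ z = (Y.frameInv η z).conjTranspose * (Y.metric η z * P z) * Y.frameInv η z := by
      simp only [φ, metric, ← Matrix.mul_assoc, h1, Matrix.one_mul]
    rw [h2]
    exact Matrix.isHermitian_conjTranspose_mul_mul _ (hHP z hz)
  have hφφ : ∀ z ∈ Disc, φ z * φ z = φ z := by
    intro z hz
    calc φ z * φ z = Y.frame η z * P z * (Y.frameInv η z * Y.frame η z) * P z * Y.frameInv η z := by
          simp only [φ, Matrix.mul_assoc]
      _ = Y.frame η z * (P z * P z) * Y.frameInv η z := by
          rw [frameInv_mul_frame, Matrix.mul_one]; simp only [Matrix.mul_assoc]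
      _ = φ z := by rw [hPP z hz]
  have hψφ : ∀ z, ψ z = Y.expY (conj z) * φ z * Y.expY (-conj z) := by
    intro z
    have h1 := Y.expY_neg_mul (-conj z)
    rw [neg_neg] at h1
    calc ψ z = (Y.expY (conj z) * Y.expY (-conj z)) * Y.expH η (rad z) * P z *
            Y.expH η (-rad z) * (Y.expY (conj z) * Y.expY (-conj z)) := by
          rw [h1, Matrix.one_mul, Matrix.mul_one]
      _ = _ := by simp only [φ, frame_eq, frameInv, Matrix.mul_assoc]
  have hψP : ∀ z p q, ψ z p q =
      Complex.exp (-(2 * rad z * (η + (p.1 : ℕ)))) * P z p q *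
        Complex.exp (-(2 * -rad z * (η + (q.1 : ℕ)))) := by
    intro z p q
    simp only [ψ, expH]
    rw [Matrix.mul_diagonal, Matrix.diagonal_mul]
  have hPψ : ∀ z p q, P z p q = ψ z p q * Complex.exp (-(2 * rad z * ((q.1 : ℕ) - (p.1 : ℕ)))) := by
    intro z p q
    rw [hψP, mul_comm (Complex.exp _) (P z p q), mul_assoc, mul_assoc, ← Complex.exp_add,
      ← Complex.exp_add]
    convert (mul_one _).symm using 2
    rw [← Complex.exp_zero]
    congr 1
    ring
  -- `P p q = ψ p q (1 - |z|²)^(q - p)` on levels, and `ψ` is bounded because the projection `φ` and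
  -- the unipotent factors are. Above the diagonal the exponent is at least `1`, so
  -- `eq_zero_of_norm_le` applies.
  have hlow : ∀ z ∈ Disc, IsLower (P z) := by
    obtain ⟨K, hK, hYK⟩ := Y.exists_norm_expY_le
    intro z hz p q hpq
    refine eq_zero_of_norm_le (C := Fintype.card Y.Idx * (Fintype.card Y.Idx * K * K))
      (hP p q) (fun z hz => ?_) hz
    have hz' : ‖conj z‖ ≤ 1 := by
      have : ‖z‖ < 1 := by simpa using hz
      rw [RCLike.norm_conj]; exact this.le
    have hψ : ‖ψ z p q‖ ≤ Fintype.card Y.Idx * (Fintype.card Y.Idx * K * K) := by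
      rw [hψφ]
      exact norm_mul_mul_apply_le hK (hYK _ hz')
        (norm_apply_le_one_of_isHermitian (hφH z hz) (hφφ z hz))
        (hYK _ (by rwa [norm_neg])) p q
    rw [hPψ, norm_mul]
    refine mul_le_mul hψ ?_ (norm_nonneg _) (by positivity)
    have hrad : 0 ≤ rad z := by
      have h1 := CoverSU.one_sub_pos hz
      have h2 := Real.log_nonpos h1.le (by nlinarith [sq_nonneg ‖z‖])
      rw [rad]; linarith
    have hqp : ((p.1 : ℕ) : ℝ) + 1 ≤ ((q.1 : ℕ) : ℝ) := by exact_mod_cast hpq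
    rw [← CoverSU.exp_neg_two_rad hz, Complex.norm_exp, Real.exp_le_exp]
    have h3 : (-(2 * (rad z : ℂ) * (((q.1 : ℕ) : ℂ) - ((p.1 : ℕ) : ℂ)))).re =
        -(2 * rad z * (((q.1 : ℕ) : ℝ) - ((p.1 : ℕ) : ℝ))) := by
      rw [← Complex.ofReal_re (-(2 * rad z * (((q.1 : ℕ) : ℝ) - ((p.1 : ℕ) : ℝ))))]
      push_cast
      rfl
    rw [h3]
    nlinarith
  have hψlow : ∀ z ∈ Disc, IsLower (ψ z) := fun z hz p q hpq => by
    rw [hψP, hlow z hz p q hpq, mul_zero, zero_mul]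
  have hφψ : ∀ z, Y.expY (conj z) * φ z = ψ z * Y.expY (conj z) := fun z => by
    rw [hψφ, Matrix.mul_assoc _ (Y.expY (-conj z)), expY_neg_mul, Matrix.mul_one]
  have hφlow : ∀ z ∈ Disc, IsLower (φ z) := fun z hz => by
    have h : φ z = Y.expY (-conj z) * ψ z * Y.expY (conj z) := by
      rw [Matrix.mul_assoc, ← hφψ, ← Matrix.mul_assoc, expY_neg_mul, Matrix.one_mul]
    rw [h]
    exact ((Y.isLower_expY _).mul (hψlow z hz)).mul (Y.isLower_expY _)
  -- A Hermitian matrix that is block lower triangular is block diagonal.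
  have hφlev : ∀ z ∈ Disc, PreservesLevel (φ z) := fun z hz p q hpq => by
    rcases lt_or_gt_of_ne hpq with h | h
    · exact hφlow z hz p q h
    · rw [← (hφH z hz).apply p q, hφlow z hz q p h, star_zero]
  have hψP' : ∀ z (p q : Y.Idx), (p.1 : ℕ) = q.1 → ψ z p q = P z p q := fun z p q h => by
    rw [hPψ, h]; simp
  have hφP : ∀ z ∈ Disc, ∀ p q : Y.Idx, (p.1 : ℕ) = q.1 → φ z p q = P z p q := by
    intro z hz p q h
    rw [← (hφlow z hz).expY_mul_apply (conj z) h, hφψ,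
      (hψlow z hz).mul_expY_apply _ h, hψP' _ _ _ h]
  have hφ0 : φ 0 = P 0 := by
    simp [φ, frame_zero, frameInv, rad, expH_zero, expY_zero]
  have hlev : PreservesLevel (P 0) := hφ0 ▸ hφlev 0 CoverSU.zero_mem
  refine ⟨hlev, ?_⟩
  ext p q
  by_cases hpq : (p.1 : ℕ) = q.1 + 1
  -- The first subdiagonal of `hφψ`: the subdiagonal blocks of `φ` vanish, the diagonal blocks of
  -- `φ` and `ψ` are those of `P`, and the subdiagonal ones of `ψ` are `(1 - |z|²) P`.
  · have := eq_zero_of_conj_mul_eq (h := fun z => (Y.mat * P z - P z * Y.mat) p q)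
      (k := fun z => P z p q) ?_ ((hP p q).differentiableAt (Metric.ball_mem_nhds 0 one_pos)) ?_
    · simpa [sub_eq_zero] using this
    · have hc : HolomorphicOnDisc fun _ => Y.mat := fun i j => differentiableOn_const _
      exact ((hc.mul hP p q).sub (hP.mul hc p q)).differentiableAt
        (Metric.ball_mem_nhds 0 one_pos)
    · intro z hz
      have h := congrFun (congrFun (hφψ z) p) q
      rw [(hφlow z hz).expY_mul_apply_succ _ hpq, (hψlow z hz).mul_expY_apply_succ _ hpq,
        hφlev z hz p q (by omega), mat_mul_congr (hφP z hz) hpq, mul_mat_congr (hψP' z) hpq] at h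
      have h2 : ψ z p q = (1 - conj z * z) * P z p q := by
        rw [hψP, hpq, expH_exponent, exp_neg_two_rad hz, mul_assoc, mul_assoc,
          mul_left_comm (Complex.exp _) (P z p q), ← Complex.exp_add]
        congr 1
        convert mul_one _ using 2
        rw [← Complex.exp_zero]
        congr 1
        ring
      rw [← h2, Matrix.sub_apply]
      linear_combination h
  · rw [mat_mul_apply_of_ne hlev hpq, mul_mat_apply_of_ne hlev hpq]

lemma splits_of_isomorphic_sum {η : ℝ} {E₁ E₂ : HermBundle} [h₁ : Nonempty E₁.ι]
    [h₂ : Nonempty E₂.ι] (h : (Y.bundle η).toHermBundle.Isomorphic (E₁.sum E₂)) : Y.Splits := by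
  obtain ⟨F, hF, hinv, hiso⟩ := h
  change ℂ → Matrix (E₁.ι ⊕ E₂.ι) Y.Idx ℂ at F
  replace hinv : ∀ z ∈ Disc, ∃ G : Matrix Y.Idx (E₁.ι ⊕ E₂.ι) ℂ, F z * G = 1 ∧ G * F z = 1 := hinv
  have hcard : Fintype.card Y.Idx = Fintype.card (E₁.ι ⊕ E₂.ι) := by
    obtain ⟨G, hG1, hG2⟩ := hinv 0 CoverSU.zero_mem
    exact Matrix.square_of_invertible G (F 0) hG2 hG1
  -- An arbitrary reindexing: it only makes the isomorphism a square matrix, so that its inverse is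
  -- available as a holomorphic function.
  let e : Y.Idx ≃ E₁.ι ⊕ E₂.ι := Fintype.equivOfCardEq hcard
  let M : ℂ → Matrix Y.Idx Y.Idx ℂ := fun z => (F z).submatrix e id
  have hM : HolomorphicOnDisc M := fun i j => hF (e i) j
  have hMu : ∀ z ∈ Disc, IsUnit (M z) := fun z hz => by
    obtain ⟨G, hG1, hG2⟩ := hinv z hz
    refine IsUnit.of_mul_eq_one (G.submatrix id e) ?_
    rw [← Matrix.submatrix_mul _ _ e id e Function.bijective_id, hG1, Matrix.submatrix_one_equiv]
  have hMM : ∀ z ∈ Disc, M z * (M z)⁻¹ = 1 := fun z hz =>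
    Matrix.mul_nonsing_inv _ ((Matrix.isUnit_iff_isUnit_det _).1 (hMu z hz))
  have hMM' : ∀ z ∈ Disc, (M z)⁻¹ * M z = 1 := fun z hz => mul_eq_one_comm.1 (hMM z hz)
  let Q : Matrix Y.Idx Y.Idx ℂ := (fstProj E₁.ι E₂.ι).submatrix e e
  have hQQ : Q * Q = Q := by
    rw [Matrix.submatrix_mul_equiv, Matrix.fromBlocks_multiply]
    simp [Q]
  -- The projection onto the first summand, pulled back to `E^{(η, Y)}`. It is orthogonal for the
  -- metric because the sum is orthogonal (`hHP`).
  let P : ℂ → Matrix Y.Idx Y.Idx ℂ := fun z => (M z)⁻¹ * Q * M z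
  have hQc : HolomorphicOnDisc fun _ => Q := fun i j => differentiableOn_const _
  have hPholo : HolomorphicOnDisc P := ((hM.inv hMu).mul hQc).mul hM
  have hPP : ∀ z ∈ Disc, P z * P z = P z := fun z hz => by
    calc P z * P z = (M z)⁻¹ * Q * (M z * (M z)⁻¹) * Q * M z := by
          simp only [P, Matrix.mul_assoc]
      _ = (M z)⁻¹ * (Q * Q) * M z := by
          rw [hMM z hz, Matrix.mul_one]; simp only [Matrix.mul_assoc]
      _ = P z := by rw [hQQ]
  have hHP : ∀ z ∈ Disc, (Y.metric η z * P z).IsHermitian := fun z hz => by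
    let B : Matrix (E₁.ι ⊕ E₂.ι) (E₁.ι ⊕ E₂.ι) ℂ := Matrix.fromBlocks (E₁.H z) 0 0 (E₂.H z)
    have h1 : Y.metric η z = (M z).conjTranspose * B.submatrix e e * M z := by
      have h2 : (F z).conjTranspose * B * F z = Y.metric η z := hiso z hz
      rw [← h2, Matrix.conjTranspose_submatrix, Matrix.submatrix_mul_equiv,
        Matrix.submatrix_mul_equiv, Matrix.submatrix_id_id]
    have h3 : Y.metric η z * P z = (M z).conjTranspose * (B.submatrix e e * Q) * M z := by
      calc Y.metric η z * P z
          = (M z).conjTranspose * B.submatrix e e * (M z * (M z)⁻¹) * Q * M z := by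
            rw [h1]; simp only [P, Matrix.mul_assoc]
        _ = _ := by rw [hMM z hz, Matrix.mul_one]; simp only [Matrix.mul_assoc]
    rw [h3]
    apply Matrix.isHermitian_conjTranspose_mul_mul
    rw [Matrix.submatrix_mul_equiv, Matrix.fromBlocks_multiply]
    apply Matrix.IsHermitian.submatrix
    simp only [Matrix.mul_one, Matrix.mul_zero, add_zero]
    exact Matrix.IsHermitian.fromBlocks (E₁.posDef z hz).isHermitian (by simp) (by simp)
  have hQP : Q = M 0 * P 0 * (M 0)⁻¹ := by
    have h0 := hMM 0 CoverSU.zero_mem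
    simp only [P, ← Matrix.mul_assoc, h0, Matrix.one_mul]
    rw [Matrix.mul_assoc, h0, Matrix.mul_one]
  obtain ⟨hlev, hcomm⟩ := preservesLevel_and_commutes_of_projection hPholo hPP hHP
  have hP0 := hHP 0 CoverSU.zero_mem
  rw [metric_zero, Matrix.one_mul] at hP0
  refine splits_of_projection hP0 (hPP 0 CoverSU.zero_mem) hlev hcomm (fun h0 => ?_) fun h1 => ?_
  · rw [h0, Matrix.mul_zero, Matrix.zero_mul] at hQP
    obtain ⟨i⟩ := h₁
    have := congrFun (congrFun hQP (e.symm (Sum.inl i))) (e.symm (Sum.inl i))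
    simp [Q] at this
  · rw [h1, Matrix.mul_one, hMM 0 CoverSU.zero_mem] at hQP
    obtain ⟨i⟩ := h₂
    have := congrFun (congrFun hQP (e.symm (Sum.inr i))) (e.symm (Sum.inr i))
    simp [Q] at this

end BlockMatrix

/-! ### Diagonalization of the stabilizer on the fibre at `0`. -/

section
open scoped MatrixOrder Matrix.Norms.L2Operator

lemma Matrix.PosSemidef.exists_eq_conjTranspose_mul_self {n : Type} [Fintype n] [DecidableEq n]
    {A : Matrix n n ℂ} (hA : A.PosSemidef) : ∃ B : Matrix n n ℂ, A = B.conjTranspose * B :=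
  CStarAlgebra.nonneg_iff_eq_star_mul_self.mp hA.nonneg

end

/-- A differentiable function on the line with `f' = c f` is an exponential. -/
lemma eq_mul_exp_of_hasDerivAt {f : ℝ → ℂ} {c : ℂ} (hf : ∀ t, HasDerivAt f (f t * c) t) (t : ℝ) :
    f t = f 0 * Complex.exp (t * c) := by
  have h1 : ∀ t : ℝ, HasDerivAt (fun t : ℝ => f t * Complex.exp (-(t * c))) 0 t := fun t => by
    have h2 : HasDerivAt (fun t : ℝ => -((t : ℂ) * c)) (-(1 * c)) t :=
      ((Complex.ofRealCLM.hasDerivAt (x := t)).mul_const c).neg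
    refine ((hf t).mul h2.cexp).congr_deriv ?_
    ring
  have h3 := is_const_of_deriv_eq_zero (fun t => (h1 t).differentiableAt)
    (fun t => (h1 t).deriv) t 0
  simp only [Complex.ofReal_zero, zero_mul, neg_zero, Complex.exp_zero, mul_one] at h3
  rw [← h3, mul_assoc, ← Complex.exp_add, neg_add_cancel, Complex.exp_zero, mul_one]

/-- A one-parameter group of isometries of a finite-dimensional Hermitian space is diagonal in an
orthonormal basis. -/
lemma exists_diagonalization {n : Type} [Fintype n] [DecidableEq n] {H : Matrix n n ℂ}
    (hH : H.PosDef) {U : ℝ → Matrix n n ℂ} (h0 : U 0 = 1) (hadd : ∀ s t, U (s + t) = U s * U t)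
    (hd : ∀ p q, DifferentiableAt ℝ (fun t => U t p q) 0)
    (hU : ∀ t, (U t).conjTranspose * H * U t = H) :
    ∃ (μ : n → ℝ) (C D : Matrix n n ℂ), C * D = 1 ∧ D * C = 1 ∧ C.conjTranspose * C = H ∧
      ∀ t, C * U t = Matrix.diagonal (fun p => Complex.exp (Complex.I * t * μ p)) * C := by
  obtain ⟨B, hB⟩ := hH.posSemidef.exists_eq_conjTranspose_mul_self
  have hBu : IsUnit B.det := by
    have h := (Matrix.isUnit_iff_isUnit_det _).1 hH.isUnit
    rw [hB, Matrix.det_mul] at h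
    exact isUnit_of_mul_isUnit_right h
  have hB1 : B * B⁻¹ = 1 := Matrix.mul_nonsing_inv _ hBu
  have hB2 : B⁻¹ * B = 1 := Matrix.nonsing_inv_mul _ hBu
  let A : Matrix n n ℂ := fun p q => deriv (fun t => U t p q) 0
  have hA : ∀ p q, HasDerivAt (fun t => U t p q) (A p q) 0 := fun p q => (hd p q).hasDerivAt
  -- The derivative at `0` of the invariance of `H`.
  have hskew : A.conjTranspose * H + H * A = 0 := by
    ext p q
    have h1 : HasDerivAt (fun t => ((U t).conjTranspose * (H * U t)) p q)
        ((A.conjTranspose * (H * U 0)) p q + ((U 0).conjTranspose * (H * A)) p q) 0 := by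
      simp only [Matrix.mul_apply, Matrix.conjTranspose_apply, ← Finset.sum_add_distrib]
      exact HasDerivAt.fun_sum fun r _ => (hA r p).star.mul
        (HasDerivAt.fun_sum fun s _ => (hA s q).const_mul _)
    have h2 : HasDerivAt (fun t => ((U t).conjTranspose * (H * U t)) p q) 0 0 := by
      simp only [← Matrix.mul_assoc, hU]
      exact hasDerivAt_const _ _
    have h3 := h1.unique h2
    rw [h0] at h3
    simpa using h3
  -- As `H = B* B`, conjugation by `B` makes the generator `A` skew-Hermitian for the standard form,
  -- and `-i` makes it Hermitian.
  let L : Matrix n n ℂ := (-Complex.I) • (B * A * B⁻¹)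
  have hL : L.IsHermitian := by
    have h1 : (B * A * B⁻¹).conjTranspose = -(B * A * B⁻¹) := by
      have h2 : B⁻¹.conjTranspose * B.conjTranspose = 1 := by
        rw [← Matrix.conjTranspose_mul, hB1, Matrix.conjTranspose_one]
      have h3 := congrArg (fun M => B⁻¹.conjTranspose * M * B⁻¹) hskew
      simp only [Matrix.mul_add, Matrix.add_mul, Matrix.mul_zero, Matrix.zero_mul, hB] at h3
      rw [eq_neg_iff_add_eq_zero, ← h3]
      congr 1
      · simp only [Matrix.conjTranspose_mul, Matrix.mul_assoc, hB1, Matrix.mul_one]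
      · simp only [← Matrix.mul_assoc, h2, Matrix.one_mul]
    rw [Matrix.IsHermitian, Matrix.conjTranspose_smul, h1]
    simp [L]
  set V : Matrix n n ℂ := (hL.eigenvectorUnitary : Matrix n n ℂ)
  have hV1 : V.conjTranspose * V = 1 := Unitary.coe_star_mul_self _
  have hV2 : V * V.conjTranspose = 1 := Unitary.coe_mul_star_self _
  have hVL : V.conjTranspose * L * V = Matrix.diagonal (fun i => (hL.eigenvalues i : ℂ)) := by
    have h1 := hL.conjStarAlgAut_star_eigenvectorUnitary
    rwa [Unitary.conjStarAlgAut_star_apply] at h1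
  set C := V.conjTranspose * B
  set D := B⁻¹ * V
  have hCD : C * D = 1 := by
    rw [Matrix.mul_assoc, ← Matrix.mul_assoc B, hB1, Matrix.one_mul, hV1]
  have hDC : D * C = 1 := mul_eq_one_comm.1 hCD
  have hCAD : C * A * D = Matrix.diagonal (fun i => Complex.I * (hL.eigenvalues i : ℂ)) := by
    have h1 : C * A * D = Complex.I • (V.conjTranspose * L * V) := by
      simp only [C, D, L, Matrix.mul_smul, Matrix.smul_mul, smul_smul, mul_neg, Complex.I_mul_I,
        neg_neg, one_smul, Matrix.mul_assoc]
    rw [h1, hVL, ← Matrix.diagonal_smul]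
    rfl
  refine ⟨hL.eigenvalues, C, D, hCD, hDC, ?_, fun t => ?_⟩
  · rw [Matrix.conjTranspose_mul, Matrix.conjTranspose_conjTranspose, Matrix.mul_assoc,
      ← Matrix.mul_assoc V, hV2, Matrix.one_mul, hB]
  -- The group law gives `X (t + s) = X t * X s` for `X t = C * U t * D`. Its derivative at `s = 0`
  -- is a linear equation that is already decoupled entry by entry, as the generator is diagonal.
  have hX : ∀ p q t, HasDerivAt (fun t => (C * U t * D) p q)
      ((C * U t * D) p q * (Complex.I * hL.eigenvalues q)) t := by
    intro p q t
    have h1 : HasDerivAt (fun s => (C * U t * D * (C * U s * D)) p q)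
        ((C * U t * D * (C * A * D)) p q) 0 := by
      simp only [Matrix.mul_apply]
      exact HasDerivAt.fun_sum fun r _ => HasDerivAt.const_mul _ (HasDerivAt.fun_sum fun s _ =>
        HasDerivAt.mul_const (HasDerivAt.fun_sum fun k _ => HasDerivAt.const_mul _ (hA k s)) _)
    have h2 : ∀ s, C * U t * D * (C * U s * D) = C * U (t + s) * D := fun s => by
      calc C * U t * D * (C * U s * D) = C * U t * (D * C) * U s * D := by
            simp only [Matrix.mul_assoc]
        _ = _ := by rw [hDC, Matrix.mul_one, hadd, Matrix.mul_assoc C]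
    rw [hCAD, Matrix.mul_diagonal] at h1
    simp only [h2] at h1
    rw [← sub_self t] at h1
    simpa using h1.comp_sub_const t t
  have hXt : C * U t * D = Matrix.diagonal
      (fun p => Complex.exp (Complex.I * t * hL.eigenvalues p)) := by
    ext p q
    rw [eq_mul_exp_of_hasDerivAt (hX p q) t, h0, Matrix.mul_one, hCD]
    rcases eq_or_ne p q with rfl | hpq
    · rw [Matrix.one_apply_eq, Matrix.diagonal_apply_eq, one_mul]
      congr 1
      ring
    · rw [Matrix.one_apply_ne hpq, Matrix.diagonal_apply_ne _ hpq, zero_mul]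
  rw [← hXt, Matrix.mul_assoc _ D, hDC, Matrix.mul_one]

/-! ### Calculus of the antiholomorphic derivative at `0`. -/

/-- `f` is real differentiable at `0`, with antiholomorphic derivative `s`. -/
def HasDbar (f : ℂ → ℂ) (s : ℂ) : Prop :=
  ∃ a : ℂ, HasFDerivAt f
    (a • ContinuousLinearMap.id ℝ ℂ + s • Complex.conjCLE.toContinuousLinearMap) 0

lemma DifferentiableAt.exists_hasDbar {f : ℂ → ℂ} (hf : DifferentiableAt ℝ f 0) :
    ∃ s, HasDbar f s := by
  have h := hf.hasFDerivAt
  set L := fderiv ℝ f 0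
  -- The Wirtinger derivatives: the first witness is `∂f/∂z̄`, the second `∂f/∂z`.
  refine ⟨(L 1 + Complex.I * L Complex.I) / 2, (L 1 - Complex.I * L Complex.I) / 2,
    h.congr_fderiv ?_⟩
  ext v
  have hv : L v = v.re * L 1 + v.im * L Complex.I := by
    conv_lhs => rw [← Complex.re_add_im v, ← mul_one (v.re : ℂ)]
    simp only [← Complex.real_smul, map_add, map_smul]
  rw [hv]
  simp only [add_apply, smul_apply,
    ContinuousLinearMap.id_apply, ContinuousLinearEquiv.coe_coe, Complex.conjCLE_apply, smul_eq_mul]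
  conv_rhs => rw [← Complex.re_add_im v]
  simp only [map_add, map_mul, Complex.conj_ofReal, Complex.conj_I]
  linear_combination ((v.im : ℂ) * L Complex.I) * Complex.I_sq

namespace HasDbar

variable {f g : ℂ → ℂ} {s t : ℂ}

lemma unique (hf : HasDbar f s) (hf' : HasDbar f t) : s = t := by
  obtain ⟨a, ha⟩ := hf
  obtain ⟨b, hb⟩ := hf'
  have h := ha.unique hb
  have e1 := congrArg (fun L : ℂ →L[ℝ] ℂ => L 1) h
  have e2 := congrArg (fun L : ℂ →L[ℝ] ℂ => L Complex.I) h
  simp at e1 e2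
  have e3 : Complex.I * (2 * (s - t)) = 0 := by linear_combination Complex.I * e1 - e2
  simpa [sub_eq_zero] using e3

lemma of_differentiableAt (hf : DifferentiableAt ℂ f 0) : HasDbar f 0 := by
  refine ⟨deriv f 0, (hf.hasFDerivAt.restrictScalars ℝ).congr_fderiv ?_⟩
  ext
  simp [mul_comm]

lemma differentiableAt (hf : HasDbar f 0) : DifferentiableAt ℂ f 0 := by
  obtain ⟨a, ha⟩ := hf
  have : HasFDerivAt f (a • ContinuousLinearMap.id ℂ ℂ) 0 := by
    refine hasFDerivAt_of_restrictScalars ℝ ha ?_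
    ext
    simp
  exact this.differentiableAt

lemma mul (hf : HasDbar f s) (hg : HasDbar g t) :
    HasDbar (fun z => f z * g z) (s * g 0 + f 0 * t) := by
  obtain ⟨a, ha⟩ := hf
  obtain ⟨b, hb⟩ := hg
  refine ⟨a * g 0 + f 0 * b, (ha.mul hb).congr_fderiv ?_⟩
  ext
  simp
  ring

lemma const (c : ℂ) : HasDbar (fun _ => c) 0 := of_differentiableAt (differentiableAt_const c)

lemma add (hf : HasDbar f s) (hg : HasDbar g t) : HasDbar (fun z => f z + g z) (s + t) := by
  obtain ⟨a, ha⟩ := hf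
  obtain ⟨b, hb⟩ := hg
  refine ⟨a + b, (ha.add hb).congr_fderiv ?_⟩
  ext
  simp
  ring

lemma sum {ι : Type} [Fintype ι] {f : ι → ℂ → ℂ} {s : ι → ℂ} (hf : ∀ i, HasDbar (f i) (s i)) :
    HasDbar (fun z => ∑ i, f i z) (∑ i, s i) := by
  classical
  have h : ∀ u : Finset ι, HasDbar (fun z => ∑ i ∈ u, f i z) (∑ i ∈ u, s i) := by
    intro u
    induction u using Finset.induction_on with
    | empty => simpa using const 0
    | insert i u hi ih => simpa only [Finset.sum_insert hi] using (hf i).add ih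
  exact h _

lemma mul_apply {l m n : Type} [Fintype m] {M : ℂ → Matrix l m ℂ} {N : ℂ → Matrix m n ℂ}
    {S : Matrix l m ℂ} {T : Matrix m n ℂ} (hM : ∀ p q, HasDbar (fun z => M z p q) (S p q))
    (hN : ∀ p q, HasDbar (fun z => N z p q) (T p q)) (p : l) (q : n) :
    HasDbar (fun z => (M z * N z) p q) ((S * N 0 + M 0 * T) p q) := by
  simp only [Matrix.add_apply, Matrix.mul_apply, ← Finset.sum_add_distrib]
  exact sum fun r => (hM p r).mul (hN r q)

lemma congr (hf : HasDbar f s) (h : ∀ z ∈ Disc, g z = f z) : HasDbar g s := by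
  obtain ⟨a, ha⟩ := hf
  exact ⟨a, ha.congr_of_eventuallyEq
    (Filter.eventuallyEq_of_mem (Metric.ball_mem_nhds 0 one_pos) h)⟩

lemma comp_mul (hf : HasDbar f s) (c : ℂ) : HasDbar (fun z => f (c * z)) (conj c * s) := by
  obtain ⟨a, ha⟩ := hf
  have h1 : HasFDerivAt (fun z : ℂ => c * z) (c • ContinuousLinearMap.id ℝ ℂ) 0 :=
    (hasFDerivAt_id (𝕜 := ℝ) (0 : ℂ)).const_mul c
  rw [← mul_zero c] at ha
  refine ⟨a * c, (ha.comp 0 h1).congr_fderiv ?_⟩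
  ext
  simp
  ring

lemma comp_conj (hf : HasDerivAt f s 0) : HasDbar (fun z => f (conj z)) s := by
  have h1 : HasFDerivAt (fun z : ℂ => conj z) Complex.conjCLE.toContinuousLinearMap (0 : ℂ) :=
    Complex.conjCLE.hasFDerivAt
  rw [← map_zero (starRingEnd ℂ)] at hf
  refine ⟨0, ((hf.hasFDerivAt.restrictScalars ℝ).comp 0 h1).congr_fderiv ?_⟩
  ext
  simp [mul_comm]

end HasDbar

namespace CoverSU

lemma rot_eq_coord (t : ℝ) : rot t = coord (-t / 2, 0) := by
  rw [← coord.apply_symm_apply (rot t)]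
  congr 1
  change ((rot t).w.im, (rot t).b) = _
  rw [rot_w, rot_b]
  simp [neg_div]

end CoverSU

lemma differentiableAt_matrix_mul {l m n : Type} [Fintype m] {M : ℂ → Matrix l m ℂ}
    {N : ℂ → Matrix m n ℂ} {z : ℂ} (hM : ∀ i j, DifferentiableAt ℂ (fun w => M w i j) z)
    (hN : ∀ i j, DifferentiableAt ℂ (fun w => N w i j) z) (i : l) (j : n) :
    DifferentiableAt ℂ (fun w => (M w * N w) i j) z := by
  simp only [Matrix.mul_apply]
  exact DifferentiableAt.fun_sum fun r _ => (hM i r).mul (hN r j)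

namespace BlockMatrix

lemma hasDerivAt_expY (Y : BlockMatrix) (p q : Y.Idx) :
    HasDerivAt (fun s => Y.expY s p q) (Y.mat p q) 0 := by
  rcases lt_or_ge (p.1 : ℕ) q.1 with h | h
  · simp only [Y.expY_apply_of_lt _ h, Y.mat_apply_of_ne (p := p) (q := q) (by omega)]
    exact hasDerivAt_const _ _
  obtain ⟨k, hk⟩ := Nat.exists_eq_add_of_le h
  simp only [Y.expY_apply_of_eq_add _ hk]
  rcases eq_or_ne k 1 with rfl | hk1
  · simpa using (hasDerivAt_id (0 : ℂ)).mul_const (Y.mat p q)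
  · rw [Y.mat_apply_of_ne (by omega)]
    have h1 := (((hasDerivAt_id (0 : ℂ)).pow k).div_const (k.factorial : ℂ)).mul_const
      ((Y.mat ^ k) p q)
    refine h1.congr_deriv ?_
    rcases Nat.eq_zero_or_pos k with rfl | hk0
    · simp
    · simp [zero_pow (show k - 1 ≠ 0 by omega)]

lemma hasDbar_exp_mul_rad (c : ℂ) : HasDbar (fun z => Complex.exp (c * rad z)) 0 := by
  have h1 : HasFDerivAt (fun z : ℂ => Real.log (1 - ‖z‖ ^ 2)) (0 : ℂ →L[ℝ] ℝ) 0 := by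
    have h2 : HasFDerivAt (fun z : ℂ => 1 - ‖z‖ ^ 2) (0 : ℂ →L[ℝ] ℝ) 0 := by
      have h3 := ((hasStrictFDerivAt_norm_sq (0 : ℂ)).hasFDerivAt).const_sub 1
      refine h3.congr_fderiv ?_
      ext
      simp
    simpa using h2.log (by simp)
  have h4 : HasFDerivAt (fun z : ℂ => ((rad z : ℝ) : ℂ)) (0 : ℂ →L[ℝ] ℂ) 0 := by
    have h5 : HasFDerivAt (fun z : ℂ => rad z) (0 : ℂ →L[ℝ] ℝ) 0 := by
      refine ((h1.mul_const (2 : ℝ)⁻¹).neg.congr_fderiv (by simp)).congr_of_eventuallyEq ?_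
      exact Filter.Eventually.of_forall fun z => by simp [rad, div_eq_mul_inv]
    exact (Complex.ofRealCLM.hasFDerivAt.comp 0 h5).congr_fderiv (by simp)
  refine ⟨0, ((h4.const_mul c).cexp).congr_fderiv ?_⟩
  ext
  simp

/-- `rad` has zero derivative at `0`, so only the linear term of `exp(z̄ Y)` remains. -/
lemma hasDbar_frameInv (Y : BlockMatrix) (η : ℝ) (p q : Y.Idx) :
    HasDbar (fun z => Y.frameInv η z p q) (Y.mat p q) := by
  have h : ∀ z, Y.frameInv η z p q =
      Complex.exp (2 * ((η : ℂ) + (p.1 : ℕ)) * rad z) * Y.expY (conj z) p q := fun z => by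
    rw [frameInv, expH, Matrix.diagonal_mul]
    congr 2
    ring
  simp only [h]
  have h1 := (hasDbar_exp_mul_rad (2 * ((η : ℂ) + (p.1 : ℕ)))).mul
    (HasDbar.comp_conj (Y.hasDerivAt_expY p q))
  simpa [rad] using h1

end BlockMatrix

/-! ### Reconstruction of an elementary bundle from its fibre at `0`. -/

namespace HomBundle

lemma differentiableAt_J_lift (E : HomBundle) (p q : E.ι) :
    DifferentiableAt ℝ (fun z => E.J (CoverSU.lift z) 0 p q) 0 := by
  have h1 : ContDiffOn ℝ ∞ (fun z : ℂ => (((0 : ℝ), z * Complex.exp (BlockMatrix.rad z)), (0 : ℂ)))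
      Disc := by
    exact (contDiffOn_const.prodMk (contDiffOn_id.mul BlockMatrix.rad_smooth.cexp)).prodMk
      contDiffOn_const
  have h2 := (E.J_smooth p q).comp h1 fun z _ => ⟨trivial, CoverSU.zero_mem⟩
  exact (h2.differentiableOn (by simp)).differentiableAt (Metric.ball_mem_nhds 0 one_pos)

lemma differentiableAt_J_rot (E : HomBundle) (p q : E.ι) :
    DifferentiableAt ℝ (fun t => E.J (CoverSU.rot t) 0 p q) 0 := by
  simp only [CoverSU.rot_eq_coord]
  have h1 : ContDiff ℝ ∞ (fun t : ℝ => ((-t / 2, (0 : ℂ)), (0 : ℂ))) :=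
    ((contDiff_id.neg.div_const 2).prodMk contDiff_const).prodMk contDiff_const
  have h2 := (E.J_smooth p q).comp_contDiff h1 fun t => ⟨trivial, CoverSU.zero_mem⟩
  exact h2.differentiable (by simp) 0

lemma exists_diagonalization (E : HomBundle) :
    ∃ (μ : E.ι → ℝ) (C D : Matrix E.ι E.ι ℂ), C * D = 1 ∧ D * C = 1 ∧
      C.conjTranspose * C = E.H 0 ∧ ∀ t, C * E.J (CoverSU.rot t) 0 =
        Matrix.diagonal (fun p => Complex.exp (Complex.I * t * μ p)) * C := by
  refine _root_.exists_diagonalization (E.posDef 0 CoverSU.zero_mem)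
    (U := fun t => E.J (CoverSU.rot t) 0) ?_ ?_ E.differentiableAt_J_rot ?_
  · rw [CoverSU.rot_zero, E.J_one 0 CoverSU.zero_mem]
  · intro s t
    rw [add_comm, CoverSU.rot_add, E.J_mul _ _ 0 CoverSU.zero_mem, CoverSU.rot_mob_zero]
  · intro t
    have h := E.J_isometry (CoverSU.rot t) 0 CoverSU.zero_mem
    rw [CoverSU.rot_mob_zero] at h
    exact h.symm

/-- The operator `-ϱ(y)` on the fibre at `0`. -/
lemma exists_hasDbar_J_lift (E : HomBundle) : ∃ S : Matrix E.ι E.ι ℂ,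
    (∀ p q, HasDbar (fun z => E.J (CoverSU.lift z) 0 p q) (S p q)) ∧
    ∀ t : ℝ, Complex.exp (-(Complex.I * t)) • (E.J (CoverSU.rot t) 0 * S) =
      S * E.J (CoverSU.rot t) 0 := by
  obtain ⟨S, hS⟩ : ∃ S : Matrix E.ι E.ι ℂ, ∀ p q,
      HasDbar (fun z => E.J (CoverSU.lift z) 0 p q) (S p q) := by
    choose S hS using fun p q => (E.differentiableAt_J_lift p q).exists_hasDbar
    exact ⟨S, hS⟩
  refine ⟨S, hS, fun t => ?_⟩
  ext p q
  have hc : conj (Complex.exp (t * Complex.I)) = Complex.exp (-(Complex.I * t)) := by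
    rw [← Complex.exp_conj, map_mul, Complex.conj_ofReal, Complex.conj_I]
    congr 1
    ring
  -- `rot_mul_lift_mul_rot` gives `J_r(0) J_{lift(e^{it} z)}(0) = J_{lift z}(0) J_r(z)` for `r = rot
  -- t`. The claim compares the `z̄`-derivatives at `0`: the substitution on the left contributes
  -- `e^{-it}`, and `J_r(z)` is holomorphic.
  have h1 := HasDbar.mul_apply (M := fun _ => E.J (CoverSU.rot t) 0) (S := 0)
    (N := fun z => E.J (CoverSU.lift (Complex.exp (t * Complex.I) * z)) 0)
    (T := Complex.exp (-(Complex.I * t)) • S) (fun _ _ => HasDbar.const _)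
    (fun i j => by rw [← hc]; exact (hS i j).comp_mul _) p q
  have h2 := HasDbar.mul_apply (T := 0) hS (fun i j => HasDbar.of_differentiableAt
    ((E.J_holo (CoverSU.rot t) i j).differentiableAt (Metric.ball_mem_nhds 0 one_pos))) p q
  have h3 := h1.unique (h2.congr fun z hz => ?_)
  · rw [← Matrix.mul_smul]
    simpa using h3
  · have hz0 : (CoverSU.lift z * CoverSU.rot (-t)).mob 0 = z := by
      rw [CoverSU.mob_mul _ _ CoverSU.zero_mem, CoverSU.rot_mob_zero, CoverSU.lift_mob_zero hz]
    rw [← CoverSU.rot_mul_lift_mul_rot t hz, E.J_mul _ _ 0 CoverSU.zero_mem, hz0,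
      E.J_mul _ _ 0 CoverSU.zero_mem, CoverSU.rot_mob_zero, ← Matrix.mul_assoc,
      ← Matrix.mul_assoc]
    have h := E.J_mul_J_inv (CoverSU.rot t) CoverSU.zero_mem
    rw [CoverSU.rot_mob_zero, ← CoverSU.rot_neg] at h
    rw [h, Matrix.one_mul]

/-- A bundle is isomorphic to `E^{(η, Y)}` if the fibre at `0` is. -/
lemma isomorphic_bundle_of_fibre (E : HomBundle) (Y : BlockMatrix) (η : ℝ)
    {C : Matrix Y.Idx E.ι ℂ} {D : Matrix E.ι Y.Idx ℂ} (hCD : C * D = 1) (hDC : D * C = 1)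
    (hH : C.conjTranspose * C = E.H 0)
    (hrot : ∀ t, C * E.J (CoverSU.rot t) 0 = Y.mult η (CoverSU.rot t) 0 * C)
    {S : Matrix E.ι E.ι ℂ} (hS : ∀ p q, HasDbar (fun z => E.J (CoverSU.lift z) 0 p q) (S p q))
    (hY : Y.mat * C = -(C * S)) : E.Isomorphic (Y.bundle η) := by
  -- Equivariance under `lift z` forces this formula: pass to the fibre at `0` of `E`, identify by
  -- `C`, return in `E^{(η, Y)}`.
  let F : ℂ → Matrix Y.Idx E.ι ℂ := fun z => Y.frameInv η z * (C * E.J (CoverSU.lift z) 0)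
  have hF : ∀ g : CoverSU, Y.mult η g 0 * F (g.mob 0) = C * E.J g 0 := by
    intro g
    obtain ⟨t, ht⟩ := g.exists_eq_lift_mul_rot
    have hz := g.mob_mem CoverSU.zero_mem
    set z := g.mob 0
    rw [ht, Y.mult_mul η _ _ CoverSU.zero_mem, E.J_mul _ _ 0 CoverSU.zero_mem,
      CoverSU.rot_mob_zero, ← Y.frame_eq_mult η hz, ← Matrix.mul_assoc C, hrot]
    simp only [F, Matrix.mul_assoc]
    rw [← Matrix.mul_assoc (Y.frame η z), Y.frame_mul_frameInv, Matrix.one_mul]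
  have hmult : ∀ g, ∀ z ∈ Disc, Y.mult η g⁻¹ (g.mob z) * Y.mult η g z = 1 :=
    fun g z hz => (Y.bundle η).J_inv_mul_J g hz
  -- Write `z = u 0`, use `hF` for `u` and for `g * u`, and cancel the invertible multiplier of `u`.
  have hJ : ∀ g, ∀ z ∈ Disc, Y.mult η g z * F (g.mob z) = F z * E.J g z := by
    intro g z hz
    obtain ⟨u, rfl⟩ := BlockMatrix.exists_mob_zero hz
    have h1 := hF (g * u)
    have h2 : Y.mult η u 0 * (Y.mult η g (u.mob 0) * F (g.mob (u.mob 0))) =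
        Y.mult η u 0 * (F (u.mob 0) * E.J g (u.mob 0)) := by
      calc Y.mult η u 0 * (Y.mult η g (u.mob 0) * F (g.mob (u.mob 0)))
          = Y.mult η (g * u) 0 * F ((g * u).mob 0) := by
            rw [Y.mult_mul η _ _ CoverSU.zero_mem, CoverSU.mob_mul _ _ CoverSU.zero_mem]
            exact (Matrix.mul_assoc _ _ _).symm
        _ = (Y.mult η u 0 * F (u.mob 0)) * E.J g (u.mob 0) := by
            rw [h1, hF u, E.J_mul _ _ 0 CoverSU.zero_mem, Matrix.mul_assoc]
        _ = _ := Matrix.mul_assoc _ _ _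
    have h3 := congrArg (Y.mult η u⁻¹ (u.mob 0) * ·) h2
    simpa only [← Matrix.mul_assoc, hmult u 0 CoverSU.zero_mem, Matrix.one_mul] using h3
  -- The `z̄`-derivative of `F` at `0` is `Y C + C S`, which is zero by `hY`.
  have hF0 : ∀ p q, DifferentiableAt ℂ (fun z => F z p q) 0 := by
    intro p q
    have h1 := HasDbar.mul_apply (Y.hasDbar_frameInv η)
      (HasDbar.mul_apply (M := fun _ => C) (S := 0) (fun _ _ => HasDbar.const _) hS) p q
    have h0 : E.J (CoverSU.lift 0) 0 = 1 := by
      rw [CoverSU.lift_zero, E.J_one 0 CoverSU.zero_mem]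
    have h2 : Y.frameInv η 0 = 1 := by
      have := Y.frame_mul_frameInv η 0
      rwa [Y.frame_zero, Matrix.one_mul] at this
    rw [h0, h2, Matrix.mul_one, Matrix.one_mul, Matrix.zero_mul, zero_add, hY, neg_add_cancel] at h1
    exact HasDbar.differentiableAt (f := fun z => F z p q) h1
  refine ⟨F, ⟨fun p q z hz => ?_, fun z hz => ?_, fun z hz => ?_⟩, hJ⟩
  · obtain ⟨g, hg⟩ : ∃ g : CoverSU, g.mob z = 0 := by
      obtain ⟨u, rfl⟩ := BlockMatrix.exists_mob_zero hz
      refine ⟨u⁻¹, ?_⟩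
      rw [← CoverSU.mob_mul _ _ CoverSU.zero_mem, inv_mul_cancel]
      simp [CoverSU.mob, CoverSU.one_w, CoverSU.one_b]
    -- By equivariance this product is `F w`. As `g z = 0`, differentiability of `F` at `z` follows
    -- from that at `0`.
    have hd : DifferentiableAt ℂ
        (fun w => (Y.mult η g w * F (g.mob w) * E.J g⁻¹ (g.mob w)) p q) z := by
      have hg' := g.differentiableAt_mob hz
      have h1 : ∀ i j, DifferentiableAt ℂ (fun w => Y.mult η g w i j) z := fun i j =>
        ((Y.bundle η).J_holo g i j).differentiableAt (Metric.isOpen_ball.mem_nhds hz)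
      have h2 : ∀ i j, DifferentiableAt ℂ (fun w => F (g.mob w) i j) z := fun i j => by
        refine DifferentiableAt.comp (g := fun w => F w i j) z ?_ hg'
        rw [hg]
        exact hF0 i j
      have h3 : ∀ i j, DifferentiableAt ℂ (fun w => E.J g⁻¹ (g.mob w) i j) z := fun i j => by
        refine DifferentiableAt.comp (g := fun w => E.J g⁻¹ w i j) z ?_ hg'
        rw [hg]
        exact (E.J_holo _ i j).differentiableAt (Metric.ball_mem_nhds 0 one_pos)
      exact differentiableAt_matrix_mul (differentiableAt_matrix_mul h1 h2) h3 p q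
    refine (hd.congr_of_eventuallyEq ?_).differentiableWithinAt
    filter_upwards [Metric.isOpen_ball.mem_nhds hz] with w hw
    rw [hJ g w hw, Matrix.mul_assoc, E.J_mul_J_inv g hw, Matrix.mul_one]
  · have h1 := E.J_mul_J_inv (CoverSU.lift z) CoverSU.zero_mem
    rw [CoverSU.lift_mob_zero hz] at h1
    have h2 := mul_eq_one_comm.1 h1
    refine ⟨(E.J (CoverSU.lift z)⁻¹ z * D) * Y.frame η z, ?_, ?_⟩
    · calc F z * ((E.J (CoverSU.lift z)⁻¹ z * D) * Y.frame η z)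
          = Y.frameInv η z * (C * ((E.J (CoverSU.lift z) 0 * E.J (CoverSU.lift z)⁻¹ z) * D)) *
              Y.frame η z := by simp only [F, Matrix.mul_assoc]
        _ = 1 := by rw [h1, Matrix.one_mul, hCD, Matrix.mul_one, Y.frameInv_mul_frame]
    · calc E.J (CoverSU.lift z)⁻¹ z * D * Y.frame η z * F z
          = E.J (CoverSU.lift z)⁻¹ z * (D * (Y.frame η z * Y.frameInv η z) * C) *
              E.J (CoverSU.lift z) 0 := by simp only [F, Matrix.mul_assoc]
        _ = 1 := by rw [Y.frame_mul_frameInv, Matrix.mul_one, hDC, Matrix.mul_one, h2]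
  · have h1 := E.J_isometry (CoverSU.lift z) 0 CoverSU.zero_mem
    rw [CoverSU.lift_mob_zero hz] at h1
    have h2 : Y.frame η z * F z = C * E.J (CoverSU.lift z) 0 := by
      simp only [F, ← Matrix.mul_assoc, Y.frame_mul_frameInv, Matrix.one_mul]
    calc (F z).conjTranspose * Y.metric η z * F z
        = (Y.frame η z * F z).conjTranspose * (Y.frame η z * F z) := by
          simp only [BlockMatrix.metric, Matrix.conjTranspose_mul, Matrix.mul_assoc]
      _ = E.H z := by
          rw [h2, h1, ← hH]
          simp only [Matrix.conjTranspose_mul, Matrix.mul_assoc]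

end HomBundle

namespace HomBundle

/-- The rows of `C` are coordinates in an eigenbasis of the rotations. The sign comes from `ϱ` being
the inverse of `J`. -/
lemma isWeight_iff (E : HomBundle) {μ : E.ι → ℝ} {C D : Matrix E.ι E.ι ℂ} (hCD : C * D = 1)
    (hDC : D * C = 1) (hC : ∀ t, C * E.J (CoverSU.rot t) 0 =
      Matrix.diagonal (fun p => Complex.exp (Complex.I * t * μ p)) * C) (lam : ℂ) :
    E.IsWeight lam ↔ ∃ p, lam = -(μ p : ℂ) := by
  have hinv : ∀ t : ℝ, C * (E.J (CoverSU.rot t) 0)⁻¹ =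
      Matrix.diagonal (fun p => Complex.exp (Complex.I * t * -(μ p : ℂ))) * C := fun t => by
    rw [J_rot_inv, hC]
    congr 2
    ext p
    push_cast
    congr 1
    ring
  have hCv : ∀ (t : ℝ) (v : E.ι → ℂ), C.mulVec ((E.J (CoverSU.rot t) 0)⁻¹.mulVec v) =
      fun p => Complex.exp (Complex.I * t * -(μ p : ℂ)) * C.mulVec v p := fun t v => by
    rw [Matrix.mulVec_mulVec, hinv, ← Matrix.mulVec_mulVec]
    ext p
    rw [Matrix.mulVec_diagonal]
  have hinj : ∀ v w : E.ι → ℂ, C.mulVec v = C.mulVec w → v = w := fun v w h => by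
    have h1 := congrArg D.mulVec h
    rwa [Matrix.mulVec_mulVec, Matrix.mulVec_mulVec, hDC, Matrix.one_mulVec,
      Matrix.one_mulVec] at h1
  constructor
  · rintro ⟨v, hv, h⟩
    have hCv0 : C.mulVec v ≠ 0 := fun h0 => hv (hinj v 0 (by rw [h0, Matrix.mulVec_zero]))
    obtain ⟨p, hp⟩ := Function.ne_iff.1 hCv0
    refine ⟨p, eq_of_exp_I_mul_eq fun t => ?_⟩
    have h1 := congrFun (hCv t v) p
    rw [h t, Matrix.mulVec_smul, Pi.smul_apply, smul_eq_mul] at h1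
    exact mul_right_cancel₀ hp h1
  · rintro ⟨p, rfl⟩
    have hD : C.mulVec (D.mulVec (Pi.single p 1)) = Pi.single p 1 := by
      rw [Matrix.mulVec_mulVec, hCD, Matrix.one_mulVec]
    refine ⟨D.mulVec (Pi.single p 1), fun h0 => ?_, fun t => hinj _ _ ?_⟩
    · rw [h0, Matrix.mulVec_zero] at hD
      simpa using congrFun hD p
    · rw [hCv, Matrix.mulVec_smul, hD]
      ext q
      rcases eq_or_ne q p with rfl | hq
      · simp
      · simp [hq]

/-- A function to `{0, …, m}` enumerates its domain block by block. -/
lemma exists_equiv_sigma {n : Type} [Fintype n] {m : ℕ} (lev : n → ℕ) (hlev : ∀ p, lev p ≤ m) :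
    ∃ e : (Σ j : Fin (m + 1), Fin (Fintype.card {p // lev p = j})) ≃ n,
      ∀ r, lev (e r) = r.1 := by
  let f : n → Fin (m + 1) := fun p => ⟨lev p, Nat.lt_succ_of_le (hlev p)⟩
  let e₁ : ∀ j : Fin (m + 1), Fin (Fintype.card {p // lev p = j}) ≃ {p // f p = j} := fun j =>
    (Fintype.equivFin _).symm.trans
      (Equiv.subtypeEquivRight fun p => (Fin.ext_iff (a := f p) (b := j)).symm)
  refine ⟨(Equiv.sigmaCongrRight e₁).trans (Equiv.sigmaFiberEquiv f), fun ⟨j, a⟩ => ?_⟩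
  exact congrArg Fin.val (e₁ j a).2

lemma exists_isomorphic_bundle (E : HomBundle) (hE : E.IsElementary) :
    ∃ (η : ℝ) (Y : BlockMatrix), Y.Full ∧ E.Isomorphic (Y.bundle η) := by
  obtain ⟨η, m, hw⟩ := hE
  obtain ⟨μ, C, D, hCD, hDC, hH, hC⟩ := E.exists_diagonalization
  have hμ := E.isWeight_iff hCD hDC hC
  have hlev : ∀ p, ∃ j : ℕ, j ≤ m ∧ μ p = η + j := fun p => by
    obtain ⟨j, hj, h⟩ := (hw _).1 ((hμ _).2 ⟨p, rfl⟩)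
    exact ⟨j, hj, by exact_mod_cast neg_injective h⟩
  choose lev hlm hlev using hlev
  obtain ⟨e, he⟩ := exists_equiv_sigma lev hlm
  obtain ⟨S, hS, hSrot⟩ := E.exists_hasDbar_J_lift
  -- `ϱ(y)` in the orthonormal eigenbasis; `e` then sorts the basis by levels.
  let T₀ : Matrix E.ι E.ι ℂ := -(C * S * D)
  let T := T₀.submatrix e e
  let Y : BlockMatrix :=
    { m := m
      d := fun j => Fintype.card {p // lev p = j}
      d_zero := fun j hj => Fintype.card_eq_zero_iff.2 ⟨fun p => by
        have := hlm p.1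
        have := p.2
        omega⟩
      blk := fun j a b => if h : j + 1 < m + 1 then
        T ⟨⟨j + 1, h⟩, a⟩ ⟨⟨j, by omega⟩, b⟩ else 0 }
  have hT₀ : ∀ p q, lev p ≠ lev q + 1 → T₀ p q = 0 := by
    intro p q hpq
    by_contra hne
    apply hpq
    -- The commutation rule `hSrot` in the eigenbasis: a nonzero entry joins weights that differ by
    -- exactly one.
    have h1 : ((μ p : ℂ) - 1) = (μ q : ℂ) := by
      apply eq_of_exp_I_mul_eq
      intro t
      have h2 : Complex.exp (-(Complex.I * t)) •
          (Matrix.diagonal (fun p => Complex.exp (Complex.I * t * μ p)) * T₀) =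
          T₀ * Matrix.diagonal (fun p => Complex.exp (Complex.I * t * μ p)) := by
        have h3 : Matrix.diagonal (fun p => Complex.exp (Complex.I * t * μ p)) =
            C * E.J (CoverSU.rot t) 0 * D := by
          rw [hC, Matrix.mul_assoc, hCD, Matrix.mul_one]
        rw [h3]
        calc Complex.exp (-(Complex.I * t)) • (C * E.J (CoverSU.rot t) 0 * D * -(C * S * D))
            = -(C * (Complex.exp (-(Complex.I * t)) •
                (E.J (CoverSU.rot t) 0 * ((D * C) * S))) * D) := by
              simp only [Matrix.mul_assoc, Matrix.mul_smul, Matrix.smul_mul, Matrix.mul_neg,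
                smul_neg]
          _ = -(C * S * (D * C) * E.J (CoverSU.rot t) 0 * D) := by
              rw [hDC, Matrix.one_mul, hSrot, Matrix.mul_one, ← Matrix.mul_assoc]
          _ = T₀ * (C * E.J (CoverSU.rot t) 0 * D) := by
              simp only [T₀, Matrix.mul_assoc, Matrix.neg_mul]
      have h4 := congrFun (congrFun h2 p) q
      rw [Matrix.smul_apply, Matrix.diagonal_mul, Matrix.mul_diagonal, smul_eq_mul, ← mul_assoc,
        mul_comm (T₀ p q), ← Complex.exp_add] at h4
      rw [← mul_right_cancel₀ hne h4]
      congr 1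
      ring
    have h5 : μ p - 1 = μ q := by exact_mod_cast h1
    rw [hlev, hlev] at h5
    have h6 : (lev p : ℝ) = lev q + 1 := by linarith
    exact_mod_cast h6
  have hmat : Y.mat = T := by
    ext ⟨⟨i, hi⟩, a⟩ ⟨⟨j, hj⟩, b⟩
    by_cases hij : i = j + 1
    · subst hij
      rw [Y.mat_mk hi hj]
      exact dif_pos hi
    · rw [Y.mat_apply_of_ne (by simpa using hij)]
      refine (hT₀ _ _ ?_).symm
      rw [he, he]
      exact hij
  -- Every value of the string `-(η + j)`, `j ≤ m`, is a weight, so no level is empty.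
  have hfull : Y.Full := by
    intro j hj
    obtain ⟨p, hp⟩ := (hμ _).1 ((hw _).2 ⟨j, hj, rfl⟩)
    have h1 : η + j = μ p := by exact_mod_cast neg_injective hp
    rw [hlev] at h1
    have h2 : (lev p : ℝ) = j := by linarith
    exact Fintype.card_pos_iff.2 ⟨⟨p, by exact_mod_cast h2⟩⟩
  have hde : ∀ t : ℝ, (Matrix.diagonal
      (fun p => Complex.exp (Complex.I * t * μ p))).submatrix e e =
      Y.mult η (CoverSU.rot t) 0 := fun t => by
    rw [Y.mult_rot, Matrix.submatrix_diagonal_equiv]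
    congr 1
    ext r
    simp only [Function.comp_apply]
    rw [hlev, he]
    push_cast
    rfl
  refine ⟨η, Y, hfull, E.isomorphic_bundle_of_fibre Y η (C := C.submatrix e id)
    (D := D.submatrix id e) ?_ ?_ ?_ (fun t => ?_) hS ?_⟩
  · exact (Matrix.submatrix_mul C D e id e Function.bijective_id).symm.trans
      (by rw [hCD]; exact Matrix.submatrix_one_equiv e)
  · rw [Matrix.submatrix_mul_equiv, hDC, Matrix.submatrix_id_id]
  · rw [Matrix.conjTranspose_submatrix, Matrix.submatrix_mul_equiv, hH, Matrix.submatrix_id_id]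
  · rw [← hde, Matrix.submatrix_mul_equiv, ← hC]
    exact (Matrix.submatrix_mul C _ e id id Function.bijective_id).symm
  · rw [hmat, Matrix.submatrix_mul_equiv]
    have h1 : T₀ * C = -(C * S) := by
      simp only [T₀, Matrix.neg_mul, Matrix.mul_assoc, hDC, Matrix.mul_one]
    rw [h1]
    rfl

end HomBundle

/-! ### Irreducibility in both senses, and the conclusion. -/

lemma HermBundle.isomorphic_sum_of_homBundle {E E₁ E₂ : HomBundle}
    (h : E.Isomorphic (E₁.sum E₂)) :
    E.toHermBundle.Isomorphic (E₁.toHermBundle.sum E₂.toHermBundle) := by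
  obtain ⟨F, hF, -⟩ := h
  exact ⟨F, hF⟩

namespace BlockMatrix

/-- A splitting of `Y` yields a homogeneous decomposition, and any Hermitian decomposition splits
`Y`. Forgetting the action links the two, so the same pair of implications serves both criteria. -/
lemma bundle_isIrreducible_iff {Y : BlockMatrix} (η : ℝ) (hY : Y.Full) :
    (Y.bundle η).IsIrreducible ↔ ¬ Y.Splits := by
  refine ⟨fun h hs => h.2 (bundle_isomorphic_sum_of_splits η hs), fun h => ⟨?_, ?_⟩⟩
  · exact ⟨⟨⟨0, by omega⟩, ⟨0, hY 0 (Nat.zero_le _)⟩⟩⟩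
  · rintro ⟨E₁, E₂, h₁, h₂, hiso⟩
    exact h (splits_of_isomorphic_sum (h₁ := h₁) (h₂ := h₂)
      (HermBundle.isomorphic_sum_of_homBundle hiso))

lemma bundle_toHermBundle_isIrreducible_iff {Y : BlockMatrix} (η : ℝ) (hY : Y.Full) :
    (Y.bundle η).toHermBundle.IsIrreducible ↔ ¬ Y.Splits := by
  refine ⟨fun h hs => ?_, fun h => ⟨?_, ?_⟩⟩
  · obtain ⟨E₁, E₂, h₁, h₂, hiso⟩ := bundle_isomorphic_sum_of_splits η hs
    exact h.2 ⟨_, _, h₁, h₂, HermBundle.isomorphic_sum_of_homBundle hiso⟩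
  · exact ⟨⟨⟨0, by omega⟩, ⟨0, hY 0 (Nat.zero_le _)⟩⟩⟩
  · rintro ⟨E₁, E₂, h₁, h₂, hiso⟩
    exact h (splits_of_isomorphic_sum hiso)

end BlockMatrix

theorem mainTheorem8 :
    -- every `E^{(η, Y)}` is an elementary homogeneous holomorphic Hermitian vector bundle
    (∀ (η : ℝ) (Y : BlockMatrix), Y.Full → (Y.bundle η).IsElementary) ∧
    -- every elementary homogeneous holomorphic Hermitian vector bundle is some `E^{(η, Y)}`
    (∀ E : HomBundle, E.IsElementary →
      ∃ (η : ℝ) (Y : BlockMatrix), Y.Full ∧ E.Isomorphic (Y.bundle η)) ∧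
    -- the parameters are determined by the isomorphism class, and conversely
    (∀ (η₁ η₂ : ℝ) (Y₁ Y₂ : BlockMatrix), Y₁.Full → Y₂.Full →
      ((Y₁.bundle η₁).Isomorphic (Y₂.bundle η₂) ↔ η₁ = η₂ ∧ Y₁.UnitarilyEquiv Y₂)) ∧
    -- irreducibility, among homogeneous bundles and among all bundles
    (∀ (η : ℝ) (Y : BlockMatrix), Y.Full →
      ((Y.bundle η).IsIrreducible ↔ ¬ Y.Splits) ∧
      ((Y.bundle η).toHermBundle.IsIrreducible ↔ ¬ Y.Splits)) := by
  refine ⟨fun η Y hY => BlockMatrix.bundle_isElementary η hY,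
    fun E hE => E.exists_isomorphic_bundle hE,
    fun η₁ η₂ Y₁ Y₂ h₁ h₂ => ⟨BlockMatrix.eq_and_unitarilyEquiv_of_isomorphic h₁ h₂, ?_⟩,
    fun η Y hY => ⟨BlockMatrix.bundle_isIrreducible_iff η hY,
      BlockMatrix.bundle_toHermBundle_isIrreducible_iff η hY⟩⟩
  rintro ⟨rfl, h⟩
  exact BlockMatrix.bundle_isomorphic_of_unitarilyEquiv h₁ h₂ h
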